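/- Let $K$ be a field. A symmetric graded Lie algebra (sgLa) is a $\mathbb Z$-graded vector space $\mathfrak g$ over $K$ with a bilinear bracket $[\cdot,\cdot]_{\mathfrak g}$ of degree $1$ such that, for homogeneous $x,y,z$ (which also denote their degrees in exponents), $[x,y]_{\mathfrak g}=(-1)^{xy}[y,x]_{\mathfrak g}$ and $[x,[y,z]_{\mathfrak g}]_{\mathfrak g}=(-1)^{x+1}[[x,y]_{\mathfrak g},z]_{\mathfrak g}+(-1)^{(x+1)(y+1)}[y,[x,z]_{\mathfrak g}]_{\mathfrak g}$. For a $\mathbb Z$-graded vector space $V$ let $\mathfrak{gl}(V)=\oplus_n\mathrm{Hom}^n(V,V)$ with the graded commutator, and give $s^{-1}\mathfrak{gl}(V)$ the sgLa bracket $[s^{-1}A,s^{-1}B]=(-1)^{A}s^{-1}[A,B]$. A representation of $\mathfrak g$ on $V$ is a degree $1$ linear map $\rho:\mathfrak g\to\mathfrak{gl}(V)$ such that $s^{-1}\circ\rho$ preserves brackets, i.e. $\rho([x,y]_{\mathfrak g})=(-1)^{x+1}[\rho(x),\rho(y)]$. For a graded vector space $W$ let $\mathrm{Hom}^n(S(V),W)$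 be the space of degree $n$ linear maps from the graded symmetric algebra $S(V)=\oplus_{k\ge0}S^k(V)$ to $W$, i.e. of sequences $f=(f_k)_{k\ge0}$ of graded symmetric $k$-linear maps $f_k$ of degree $n$. Write $\varepsilon(\sigma)$ for the Koszul sign, given by $v_1\odot\cdots\odot v_p=\varepsilon(\sigma)\,v_{\sigma(1)}\odot\cdots\odot v_{\sigma(p)}$, and $\mathbb S_{(i_1,\dots,i_r)}$ for the set of $(i_1,\dots,i_r)$-unshuffles. For a sequence $f$ of graded symmetric maps on $V$ and $G\in\mathrm{Hom}^n(S(V),\mathfrak{gl}(V))$ put, for homogeneous $v_1,\dots,v_p\in V$, $$(f\triangleleft G)_p(v_1,\dots,v_p)=\sum_{0\le l<p}\ \sum_{\sigma\in\mathbb S_{(l,1,p-l-1)}}\varepsilon(\sigma)\,f_{p-l}\big(G_l(v_{\sigma(1)},\dots,v_{\sigma(l)})v_{\sigma(l+1)},v_{\sigma(l+2)},\dots,v_{\sigma(p)}\big).$$ Let $(\mathfrak g,[\cdot,\cdot]_{\mathfrak g})$ be an sgLa and $\rho$ a representation of it on $V$. On $C^*(V,\mathfrak g)=\oplus_n\mathrm{Hom}^n(S(V),\mathfrak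 g)$ define, for $f\in\mathrm{Hom}^m(S(V),\mathfrak g)$ and $g\in\mathrm{Hom}^n(S(V),\mathfrak g)$, the element $[\![f,g]\!]\in\mathrm{Hom}^{m+n+1}(S(V),\mathfrak g)$ by $$[\![f,g]\!]_p(v_1,\dots,v_p)=-\big(f\triangleleft(\rho\circ g)\big)_p(v_1,\dots,v_p)+(-1)^{(m+1)(n+1)}\big(g\triangleleft(\rho\circ f)\big)_p(v_1,\dots,v_p)$$ $$-\sum_{0\le l\le p}\ \sum_{\sigma\in\mathbb S_{(p-l,l)}}(-1)^{n(v_{\sigma(1)}+\cdots+v_{\sigma(p-l)})+m+1}\varepsilon(\sigma)\,[f_{p-l}(v_{\sigma(1)},\dots,v_{\sigma(p-l)}),g_l(v_{\sigma(p-l+1)},\dots,v_{\sigma(p)})]_{\mathfrak g}.$$ Let $sC^*(V,\mathfrak g)$ be its suspension, $(sC^*(V,\mathfrak g))^n=\mathrm{Hom}^{n-1}(S(V),\mathfrak g)$. On $\bar{\mathcal C}^*(V,V)=\oplus_n\bar{\mathcal C}^n(V,V)$, where $\bar{\mathcal C}^n(V,V)=s\mathrm{Hom}^{n-1}(S(V),s^{-1}\mathfrak{gl}(V))=\mathrm{Hom}^n(S(V),\mathfrak{gl}(V))$,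 define for $F\in\bar{\mathcal C}^m(V,V)$ and $G\in\bar{\mathcal C}^n(V,V)$ $$(F\diamond G)_p(v_1,\dots,v_p)=(F\triangleleft G)_p(v_1,\dots,v_p)+\sum_{0\le l\le p}\ \sum_{\sigma\in\mathbb S_{(p-l,l)}}(-1)^{n(v_{\sigma(1)}+\cdots+v_{\sigma(p-l)})}\varepsilon(\sigma)\,F_{p-l}(v_{\sigma(1)},\dots,v_{\sigma(p-l)})\circ G_l(v_{\sigma(p-l+1)},\dots,v_{\sigma(p)}),$$ and the Chapoton–Livernet bracket, with the sign normalization $[F,G]^c=(-1)^{mn}\,G\diamond F-F\diamond G\in\bar{\mathcal C}^{m+n}(V,V)$. **Theorem.** $(sC^*(V,\mathfrak g),[\![\cdot,\cdot]\!])$ and $(\bar{\mathcal C}^*(V,V),[\cdot,\cdot]^c)$ are graded Lie algebras, and the degree $0$ linear map $\Psi:sC^*(V,\mathfrak g)\to\bar{\mathcal C}^*(V,V)$, $\Psi(f)=s^{-1}\circ\rho\circ f$ (that is, $\rho\circ f_k$ in every arity $k$, under the identification above), is a homomorphism of graded Lie algebras: $\Psi([\![f,g]\!])=[\Psi(f),\Psi(g)]^c$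 for all $f,g$. (Equivalently, $-\Psi$ is a homomorphism for the bracket $F\diamond G-(-1)^{mn}G\diamond F$ of the opposite normalization.) -/

import Mathlib

namespace HomotopyOOperator

noncomputable section

/-! ### Unshuffles and Koszul signs -/

/-- Koszul sign `ε(σ; v₁, …, vₚ)` for homogeneous `vᵢ` of degree `d i`, i.e.
`v₁ ⊙ ⋯ ⊙ vₚ = ε(σ; v₁, …, vₚ) v_{σ(1)} ⊙ ⋯ ⊙ v_{σ(p)}`: a factor `(-1)^{|v_{σ(i)}| |v_{σ(j)}|}`
for every inversion `i < j`, `σ(j) < σ(i)`. -/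
def koszulSign {p : ℕ} (σ : Equiv.Perm (Fin p)) (d : Fin p → ℤ) : ℤˣ :=
  ∏ i : Fin p, ∏ j : Fin p,
    if i < j ∧ σ j < σ i then Int.negOnePow (d (σ i) * d (σ j)) else 1

/-- The permutations that are increasing on each block `{i | β i = c}` of positions. -/
def unshuffles {p : ℕ} (β : Fin p → ℕ) : Finset (Equiv.Perm (Fin p)) := by
  classical exact Finset.univ.filter fun σ => ∀ i j, i < j → β i = β j → σ i < σ j

/-- The `(a, p - a)`-unshuffles, for `a ≤ p`. -/
def unshuffles₂ (p a : ℕ) : Finset (Equiv.Perm (Fin p)) :=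
  unshuffles fun i => if (i : ℕ) < a then 0 else 1

/-- The `(a, 1, p - a - 1)`-unshuffles, for `a < p`. -/
def unshuffles₃ (p a : ℕ) : Finset (Equiv.Perm (Fin p)) :=
  unshuffles fun i => if (i : ℕ) < a then 0 else if (i : ℕ) = a then 1 else 2

/-! ### Graded Lie algebras -/

section GradedLie

variable {K : Type*} [Field K]

/-- `⨁ₙ L n` with the operation `br m n : L m × L n → L (m + n)` is a graded Lie algebra. The graded
pieces are submodules of one ambient space, so that equations need no transport between degrees;
`br m n` is only used on `L m × L n`. -/
structure IsGradedLieAlgebra {A : Type*} [AddCommGroup A] [Module K A] (L : ℤ → Submodule K A)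
    (br : ℤ → ℤ → A → A → A) : Prop where
  bracket_mem : ∀ m n, ∀ x ∈ L m, ∀ y ∈ L n, br m n x y ∈ L (m + n)
  add_left : ∀ m n, ∀ x ∈ L m, ∀ x' ∈ L m, ∀ y ∈ L n,
    br m n (x + x') y = br m n x y + br m n x' y
  smul_left : ∀ m n, ∀ (a : K), ∀ x ∈ L m, ∀ y ∈ L n, br m n (a • x) y = a • br m n x y
  add_right : ∀ m n, ∀ x ∈ L m, ∀ y ∈ L n, ∀ y' ∈ L n,
    br m n x (y + y') = br m n x y + br m n x y'
  smul_right : ∀ m n, ∀ (a : K), ∀ x ∈ L m, ∀ y ∈ L n, br m n x (a • y) = a • br m n x y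
  skew : ∀ m n, ∀ x ∈ L m, ∀ y ∈ L n, br m n x y = -(Int.negOnePow (m * n) • br n m y x)
  jacobi : ∀ m n p, ∀ x ∈ L m, ∀ y ∈ L n, ∀ z ∈ L p,
    br m (n + p) x (br n p y z) =
      br (m + n) p (br m n x y) z + Int.negOnePow (m * n) • br n (m + p) y (br m p x z)

/-- `φ` is a homomorphism of graded Lie algebras from `(L, br)` to `(L', br')`: both are graded Lie
algebras, and the linear map `φ` has degree `0` and preserves brackets. -/
structure IsGradedLieHom {A A' : Type*} [AddCommGroup A] [Module K A] [AddCommGroup A']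
    [Module K A'] (L : ℤ → Submodule K A) (br : ℤ → ℤ → A → A → A)
    (L' : ℤ → Submodule K A') (br' : ℤ → ℤ → A' → A' → A') (φ : A →ₗ[K] A') : Prop where
  source : IsGradedLieAlgebra L br
  target : IsGradedLieAlgebra L' br'
  map_mem : ∀ n, ∀ x ∈ L n, φ x ∈ L' n
  map_bracket : ∀ m n, ∀ x ∈ L m, ∀ y ∈ L n, φ (br m n x y) = br' m n (φ x) (φ y)

/-- Symmetric graded Lie algebras: a graded symmetric bracket of degree `1` that satisfies the graded
Leibniz rule. -/
structure IsSymmGradedLieAlgebra {𝔤 : Type*} [AddCommGroup 𝔤] [Module K 𝔤]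
    (𝒢 : ℤ → Submodule K 𝔤) (br : 𝔤 →ₗ[K] 𝔤 →ₗ[K] 𝔤) : Prop where
  bracket_mem : ∀ a b, ∀ x ∈ 𝒢 a, ∀ y ∈ 𝒢 b, br x y ∈ 𝒢 (a + b + 1)
  symm : ∀ a b, ∀ x ∈ 𝒢 a, ∀ y ∈ 𝒢 b, br x y = Int.negOnePow (a * b) • br y x
  leibniz : ∀ a b c, ∀ x ∈ 𝒢 a, ∀ y ∈ 𝒢 b, ∀ z ∈ 𝒢 c,
    br x (br y z) = Int.negOnePow (a + 1) • br (br x y) z +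
      Int.negOnePow ((a + 1) * (b + 1)) • br y (br x z)

variable {V : Type*} [AddCommGroup V] [Module K V]

/-- `gl(V)ⁿ = Homⁿ(V, V)`, the linear endomorphisms of `V` of degree `n`. -/
def glGrading (𝒱 : ℤ → Submodule K V) (n : ℤ) : Submodule K (Module.End K V) where
  carrier := {A | ∀ i, ∀ v ∈ 𝒱 i, A v ∈ 𝒱 (n + i)}
  add_mem' := fun hA hB i v hv => add_mem (hA i v hv) (hB i v hv)
  zero_mem' := fun _ _ _ => zero_mem _
  smul_mem' := fun c _ hA i v hv => Submodule.smul_mem _ c (hA i v hv)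

/-- Graded commutator of `A ∈ gl(V)ᵐ` and `B ∈ gl(V)ⁿ`. -/
def glCommutator (m n : ℤ) (A B : Module.End K V) : Module.End K V :=
  A * B - Int.negOnePow (m * n) • (B * A)

/-- The symmetric graded Lie bracket of `s⁻¹gl(V)`, `[s⁻¹A, s⁻¹B] = (-1)^{|A|} s⁻¹[A, B]`, where `a`,
`b` are the degrees of `s⁻¹A`, `s⁻¹B`, so that `A`, `B` have degrees `a + 1`, `b + 1` in `gl(V)`.
With this bracket `x ↦ [x, ·]` is a representation of any symmetric graded Lie algebra on itself. -/
def desuspGlBracket (a b : ℤ) (A B : Module.End K V) : Module.End K V :=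
  Int.negOnePow (a + 1) • glCommutator (a + 1) (b + 1) A B

/-- Representations of a symmetric graded Lie algebra on a graded vector space: `ρ : 𝔤 → gl(V)` has
degree `1`, and `s⁻¹ ∘ ρ : 𝔤 → s⁻¹gl(V)` preserves brackets. -/
structure IsSymmGradedLieRep {𝔤 : Type*} [AddCommGroup 𝔤] [Module K 𝔤]
    (𝒱 : ℤ → Submodule K V) (𝒢 : ℤ → Submodule K 𝔤) (br : 𝔤 →ₗ[K] 𝔤 →ₗ[K] 𝔤)
    (ρ : 𝔤 →ₗ[K] Module.End K V) : Prop where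
  map_mem : ∀ a, ∀ x ∈ 𝒢 a, ρ x ∈ glGrading 𝒱 (a + 1)
  map_bracket : ∀ a b, ∀ x ∈ 𝒢 a, ∀ y ∈ 𝒢 b, ρ (br x y) = desuspGlBracket a b (ρ x) (ρ y)

end GradedLie

/-! ### The spaces `Homⁿ(S(V), W)` -/

section SymHom

variable {K : Type*} [Field K] {V W : Type*} [AddCommGroup V] [Module K V]
  [AddCommGroup W] [Module K W]

/-- Sequences `(f₀, f₁, …)` of multilinear maps `f_k : V × ⋯ × V → W`. -/
abbrev MultiSeq (K V W : Type*) [Field K] [AddCommGroup V] [Module K V] [AddCommGroup W]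
    [Module K W] : Type _ :=
  ∀ k : ℕ, MultilinearMap K (fun _ : Fin k => V) W

/-- `Homⁿ(S(V), W)`: a linear map `S(V) = ⨁ₖ Sᵏ(V) → W` of degree `n` is a sequence of graded
symmetric multilinear maps `f_k` of degree `n`. -/
def symHom (𝒱 : ℤ → Submodule K V) (𝒲 : ℤ → Submodule K W) (n : ℤ) :
    Submodule K (MultiSeq K V W) where
  carrier := {f | ∀ (k : ℕ) (d : Fin k → ℤ) (v : Fin k → V), (∀ i, v i ∈ 𝒱 (d i)) →
    f k v ∈ 𝒲 (n + ∑ i, d i) ∧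
    ∀ σ : Equiv.Perm (Fin k), f k v = koszulSign σ d • f k (fun i => v (σ i))}
  add_mem' := by
    intro f g hf hg k d v hv
    refine ⟨add_mem (hf k d v hv).1 (hg k d v hv).1, fun σ => ?_⟩
    have h1 := (hf k d v hv).2 σ
    have h2 := (hg k d v hv).2 σ
    simp only [Pi.add_apply, add_apply, smul_add]
    rw [← h1, ← h2]
  zero_mem' := by
    intro k d v hv
    exact ⟨zero_mem _, fun σ => by simp⟩
  smul_mem' := by
    intro c f hf k d v hv
    refine ⟨Submodule.smul_mem _ c (hf k d v hv).1, fun σ => ?_⟩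
    have h1 := (hf k d v hv).2 σ
    simp only [Pi.smul_apply, smul_apply]
    rw [smul_comm, ← h1]

variable (𝒱 : ℤ → Submodule K V) [DirectSum.Decomposition 𝒱]

/-- The projection of `V` onto its even part (`b = 0`) or its odd part (`b = 1`). -/
def parityProj (b : Fin 2) : V →ₗ[K] V :=
  (DirectSum.toModule K ℤ V fun i =>
    if i % 2 = ((b : ℕ) : ℤ) then (𝒱 i).subtype else 0) ∘ₗ
    (DirectSum.decomposeLinearEquiv 𝒱).toLinearMap

/-- The multilinear map that on homogeneous `v₁, …, vₚ` of degrees `d` is `φ d v`, for a formula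
`φ d v` whose dependence on `d` is through the parities of the `d i` only (as signs do). -/
def ofHomogeneous {p : ℕ} (φ : (Fin p → ℤ) → MultilinearMap K (fun _ : Fin p => V) W) :
    MultilinearMap K (fun _ : Fin p => V) W :=
  ∑ c : Fin p → Fin 2,
    (φ fun i => ((c i : ℕ) : ℤ)).compLinearMap fun i => parityProj 𝒱 (c i)

theorem parityProj_of_mem {b : Fin 2} {i : ℤ} {v : V} (hv : v ∈ 𝒱 i) :
    parityProj 𝒱 b v = if i % 2 = ((b : ℕ) : ℤ) then v else 0 := by
  have h : DirectSum.decompose 𝒱 v = DirectSum.of (fun i => 𝒱 i) i ⟨v, hv⟩ :=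
    DirectSum.decompose_of_mem 𝒱 hv
  simp only [parityProj, LinearMap.comp_apply, LinearEquiv.coe_coe,
    DirectSum.decomposeLinearEquiv_apply, h]
  rw [← DirectSum.lof_eq_of K, DirectSum.toModule_lof]
  split_ifs <;> simp

theorem ofHomogeneous_apply {p : ℕ}
    {φ : (Fin p → ℤ) → MultilinearMap K (fun _ : Fin p => V) W}
    (hφ : ∀ d d' : Fin p → ℤ, (∀ i, d i % 2 = d' i % 2) → φ d = φ d')
    {d : Fin p → ℤ} {v : Fin p → V} (hv : ∀ i, v i ∈ 𝒱 (d i)) :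
    ofHomogeneous 𝒱 φ v = φ d v := by
  have hb : ∀ i, ∃ b : Fin 2, d i % 2 = ((b : ℕ) : ℤ) := by
    intro i
    rcases Int.emod_two_eq_zero_or_one (d i) with h | h
    · exact ⟨0, by simp [h]⟩
    · exact ⟨1, by simp [h]⟩
  choose b hb using hb
  rw [ofHomogeneous, sum_apply, Finset.sum_eq_single b]
  · rw [MultilinearMap.compLinearMap_apply, hφ (fun i => ((b i : ℕ) : ℤ)) d]
    · congr 1
      funext i
      rw [parityProj_of_mem 𝒱 (hv i), if_pos (hb i)]
    · intro i
      rw [← hb i]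
      simp
  · intro c _ hc
    obtain ⟨i, hi⟩ := Function.ne_iff.mp hc
    rw [MultilinearMap.compLinearMap_apply]
    refine MultilinearMap.map_coord_zero _ i ?_
    rw [parityProj_of_mem 𝒱 (hv i), if_neg]
    intro h
    apply hi
    have := h.symm.trans (hb i)
    exact Fin.ext (by exact_mod_cast this)
  · intro h
    exact absurd (Finset.mem_univ _) h

/-- `(v₁, …, v_{l+1+j}) ↦ f(g(v₁, …, v_l) v_{l+1}, v_{l+2}, …, v_{l+1+j})`. -/
def insertMap {l j : ℕ} (f : MultilinearMap K (fun _ : Fin (j + 1) => V) W)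
    (g : MultilinearMap K (fun _ : Fin l => V) (Module.End K V)) :
    MultilinearMap K (fun _ : Fin (l + 1 + j) => V) W :=
  MultilinearMap.domDomCongr finSumFinEquiv
    (MultilinearMap.uncurrySum (f.curryLeft.compMultilinearMap g.uncurryRight))

theorem insertMap_apply {l j : ℕ} (f : MultilinearMap K (fun _ : Fin (j + 1) => V) W)
    (g : MultilinearMap K (fun _ : Fin l => V) (Module.End K V)) (v : Fin (l + 1 + j) → V) :
    insertMap f g v =
      f (Fin.cons (g (fun i : Fin l => v ⟨i, by omega⟩) (v ⟨l, by omega⟩))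
        fun i : Fin j => v ⟨l + 1 + i, by omega⟩) :=
  rfl

/-- `(v₁, …, v_{k+l}) ↦ B(f(v₁, …, v_k), g(v_{k+1}, …, v_{k+l}))`. -/
def cupMap {k l : ℕ} (B : W →ₗ[K] W →ₗ[K] W)
    (f : MultilinearMap K (fun _ : Fin k => V) W) (g : MultilinearMap K (fun _ : Fin l => V) W) :
    MultilinearMap K (fun _ : Fin (k + l) => V) W :=
  MultilinearMap.domDomCongr finSumFinEquiv
    (MultilinearMap.uncurrySum (LinearMap.compMultilinearMap
      { toFun := fun w => (B w).compMultilinearMap g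
        map_add' := fun w w' => by ext; simp
        map_smul' := fun c w => by ext; simp } f))

theorem cupMap_apply {k l : ℕ} (B : W →ₗ[K] W →ₗ[K] W)
    (f : MultilinearMap K (fun _ : Fin k => V) W) (g : MultilinearMap K (fun _ : Fin l => V) W)
    (v : Fin (k + l) → V) :
    cupMap B f g v =
      B (f fun i : Fin k => v ⟨i, by omega⟩) (g fun i : Fin l => v ⟨k + i, by omega⟩) :=
  rfl

theorem negOnePow_congr {a b : ℤ} (h : a % 2 = b % 2) : Int.negOnePow a = Int.negOnePow b := by
  rw [Int.negOnePow_eq_iff, Int.even_sub, Int.even_iff, Int.even_iff, h]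

theorem koszulSign_congr {p : ℕ} (σ : Equiv.Perm (Fin p)) {d d' : Fin p → ℤ}
    (h : ∀ i, d i % 2 = d' i % 2) : koszulSign σ d = koszulSign σ d' := by
  unfold koszulSign
  refine Finset.prod_congr rfl fun i _ => Finset.prod_congr rfl fun j _ => ?_
  split_ifs
  · exact negOnePow_congr (Int.ModEq.mul (h (σ i)) (h (σ j)))
  · rfl

/-- The sequence whose `p`-th map sends homogeneous `v₁, …, vₚ` to
`∑_{0 ≤ l < p} ∑_{σ ∈ 𝕊(l, 1, p-l-1)} ε(σ) f_{p-l}(g_l(v_{σ(1)}, …, v_{σ(l)}) v_{σ(l+1)},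
v_{σ(l+2)}, …, v_{σ(p)})`; the arity of `f` is written `p - 1 - l + 1`. -/
def insertion (f : MultiSeq K V W) (g : MultiSeq K V (Module.End K V)) : MultiSeq K V W :=
  fun p => ofHomogeneous 𝒱 fun d =>
    ∑ l : Fin p, ∑ σ ∈ unshuffles₃ p l, koszulSign σ d •
      (insertMap (f (p - 1 - l + 1)) (g l)).domDomCongr
        ((finCongr (show (l : ℕ) + 1 + (p - 1 - l) = p by omega)).trans σ)

theorem insertion_apply (f : MultiSeq K V W) (g : MultiSeq K V (Module.End K V)) {p : ℕ}
    {d : Fin p → ℤ} {v : Fin p → V} (hv : ∀ i, v i ∈ 𝒱 (d i)) :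
    insertion 𝒱 f g p v = ∑ l : Fin p, ∑ σ ∈ unshuffles₃ p l, koszulSign σ d •
      f (p - 1 - l + 1) (Fin.cons
        (g l (fun i : Fin l => v (σ ⟨i, by omega⟩)) (v (σ l)))
        fun i : Fin (p - 1 - l) => v (σ ⟨l + 1 + i, by omega⟩)) := by
  rw [insertion, ofHomogeneous_apply 𝒱 _ hv]
  · simp only [sum_apply, smul_apply, MultilinearMap.domDomCongr_apply, insertMap_apply]
    rfl
  · intro d d' h
    simp only [koszulSign_congr _ h]

/-- The sequence whose `p`-th map sends homogeneous `v₁, …, vₚ` to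
`∑_{0 ≤ l ≤ p} ∑_{σ ∈ 𝕊(p-l, l)} (-1)^{n (v_{σ(1)} + ⋯ + v_{σ(p-l)})} ε(σ)
B(f_{p-l}(v_{σ(1)}, …, v_{σ(p-l)}), g_l(v_{σ(p-l+1)}, …, v_{σ(p)}))`. -/
def cup (B : W →ₗ[K] W →ₗ[K] W) (n : ℤ) (f g : MultiSeq K V W) : MultiSeq K V W :=
  fun p => ofHomogeneous 𝒱 fun d =>
    ∑ l : Fin (p + 1), ∑ σ ∈ unshuffles₂ p (p - l),
      (Int.negOnePow (n * ∑ i : Fin (p - l), d (σ ⟨i, by omega⟩)) * koszulSign σ d) •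
        (cupMap B (f (p - l)) (g l)).domDomCongr
          ((finCongr (show p - (l : ℕ) + l = p by omega)).trans σ)

theorem cup_apply (B : W →ₗ[K] W →ₗ[K] W) (n : ℤ) (f g : MultiSeq K V W) {p : ℕ}
    {d : Fin p → ℤ} {v : Fin p → V} (hv : ∀ i, v i ∈ 𝒱 (d i)) :
    cup 𝒱 B n f g p v = ∑ l : Fin (p + 1), ∑ σ ∈ unshuffles₂ p (p - l),
      (Int.negOnePow (n * ∑ i : Fin (p - l), d (σ ⟨i, by omega⟩)) * koszulSign σ d) •
        B (f (p - l) fun i : Fin (p - l) => v (σ ⟨i, by omega⟩))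
          (g l fun i : Fin l => v (σ ⟨p - l + i, by omega⟩)) := by
  rw [cup, ofHomogeneous_apply 𝒱 _ hv]
  · simp only [sum_apply, smul_apply, MultilinearMap.domDomCongr_apply, cupMap_apply]
    rfl
  · intro d d' h
    refine Finset.sum_congr rfl fun l _ => Finset.sum_congr rfl fun σ _ => ?_
    rw [koszulSign_congr σ h]
    congr 2
    refine negOnePow_congr (Int.ModEq.mul rfl ?_)
    exact Int.ModEq.sum fun i _ => h _

end SymHom

/-! ### The two graded Lie algebras and the map between them -/

section Brackets

variable {K : Type*} [Field K] {V 𝔤 : Type*} [AddCommGroup V] [Module K V]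
  [AddCommGroup 𝔤] [Module K 𝔤]

/-- The degree `n` part of `sC*(V, 𝔤)`, which is `C^{n-1}(V, 𝔤) = Hom^{n-1}(S(V), 𝔤)`. -/
def suspendedC (𝒱 : ℤ → Submodule K V) (𝒢 : ℤ → Submodule K 𝔤) (n : ℤ) :
    Submodule K (MultiSeq K V 𝔤) :=
  symHom 𝒱 𝒢 (n - 1)

/-- `C̄ⁿ(V, V) = s Hom^{n-1}(S(V), s⁻¹gl(V)) = Homⁿ(S(V), gl(V))`. -/
def barC (𝒱 : ℤ → Submodule K V) (n : ℤ) : Submodule K (MultiSeq K V (Module.End K V)) :=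
  symHom 𝒱 (glGrading 𝒱) n

/-- `f ↦ ρ ∘ f`, that is `(f_k)_k ↦ (ρ ∘ f_k)_k`. As an element of `C̄*(V, V)`, i.e. after
`s Hom^{n-1}(S(V), s⁻¹gl(V)) = Homⁿ(S(V), gl(V))`, this is `Ψ(f) = s⁻¹ ∘ ρ ∘ f`. -/
def psi (ρ : 𝔤 →ₗ[K] Module.End K V) : MultiSeq K V 𝔤 →ₗ[K] MultiSeq K V (Module.End K V) where
  toFun f := fun k => ρ.compMultilinearMap (f k)
  map_add' f g := by funext k; ext v; simp
  map_smul' c f := by funext k; ext v; simp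

variable (𝒱 : ℤ → Submodule K V) [DirectSum.Decomposition 𝒱]

/-- The bracket `⟦f, g⟧` of `f ∈ Homᵐ(S(V), 𝔤)` and `g ∈ Homⁿ(S(V), 𝔤)`. -/
def oBracket (br : 𝔤 →ₗ[K] 𝔤 →ₗ[K] 𝔤) (ρ : 𝔤 →ₗ[K] Module.End K V) (m n : ℤ)
    (f g : MultiSeq K V 𝔤) : MultiSeq K V 𝔤 :=
  -insertion 𝒱 f (psi ρ g)
    + Int.negOnePow ((m + 1) * (n + 1)) • insertion 𝒱 g (psi ρ f)
    - Int.negOnePow (m + 1) • cup 𝒱 br n f g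

/-- The bracket `⟦·, ·⟧` on `sC*(V, 𝔤)`, with `m`, `n` the degrees in `sC*(V, 𝔤)`. -/
def suspendedOBracket (br : 𝔤 →ₗ[K] 𝔤 →ₗ[K] 𝔤) (ρ : 𝔤 →ₗ[K] Module.End K V) (m n : ℤ)
    (f g : MultiSeq K V 𝔤) : MultiSeq K V 𝔤 :=
  oBracket 𝒱 br ρ (m - 1) (n - 1) f g

/-- The product `F ⋄ G` of `F ∈ Homᵐ(S(V), gl(V))` and `G ∈ Homⁿ(S(V), gl(V))`, for any `m`: on
homogeneous elements, `(F ⋄ G)_p(v₁, …, vₚ) v_{p+1}` is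
`∑ ε(σ) F_{p-l}(G_l(v_{σ(1)}, …, v_{σ(l)}) v_{σ(l+1)}, v_{σ(l+2)}, …, v_{σ(p)}) v_{p+1}` plus
`∑ (-1)^{n (v_{σ(1)} + ⋯ + v_{σ(p-l)})} ε(σ)
F_{p-l}(v_{σ(1)}, …, v_{σ(p-l)}) (G_l(v_{σ(p-l+1)}, …, v_{σ(p)}) v_{p+1})`. -/
def diamond (n : ℤ) (F G : MultiSeq K V (Module.End K V)) : MultiSeq K V (Module.End K V) :=
  insertion 𝒱 F G + cup 𝒱 (LinearMap.mul K (Module.End K V)) n F G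

/-- The bracket `[F, G]ᶜ = (-1)^{mn} G ⋄ F - F ⋄ G` of `F ∈ Homᵐ(S(V), gl(V))` and
`G ∈ Homⁿ(S(V), gl(V))`. The overall sign is the one that goes with `⟦·, ·⟧`; for either sign, in
characteristic not `2`, `[L, L]ᶜ = 0` for `L` of degree `1` says `L ⋄ L = 0`, which are the
identities of a pre-Lie∞-algebra for the operations `(v₁, …, v_k) ↦ L_{k-1}(v₁, …, v_{k-1}) v_k`. -/
def clBracket (m n : ℤ) (F G : MultiSeq K V (Module.End K V)) : MultiSeq K V (Module.End K V) :=
  Int.negOnePow (m * n) • diamond 𝒱 m G F - diamond 𝒱 n F G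

end Brackets

end

end HomotopyOOperator

/-! A map `G : S(V) → gl(V)` generates a coderivation `D_G` of `S(V)`, whose corestriction to `V` is
the cup product of `G` with the projection `S(V) → V` (`corestr`). Then `f ◁ G` is `f ∘ D_G`
(`insertion_eq_star`), and the other terms of both brackets are cup products. So everything follows
from three facts: the commutator of two coderivations is a coderivation (`star_star`), coderivations
are derivations of cup products (`star_hcup`), and cup products inherit the identities of their
bilinear map (`hcup_assoc`, `hcup_symm`, `hcup_leibniz`, `mapSeq_hcup_of_rep`).

Together they say that `⋄` describes the composition of corestrictions (`star_corestr_corestr`), so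
`⋄` is a graded right pre-Lie product (`diamond_diamond`) and its commutator satisfies Jacobi.
Because `ρ` is a representation, `Ψ` preserves brackets (`psi_suspendedOBracket`). This comes before
the Jacobi identity on `sC*(V, 𝔤)`, which uses it: the coderivation of an inner bracket is then a
commutator of coderivations, and the remaining terms are settled by the derivation rule and the
Leibniz rule of `𝔤`.

To keep unshuffles out of these computations, a sequence of maps is evaluated on lists of
homogeneous vectors, where signed sums over unshuffles become recursive sums over splittings
(`sum_unshuffles₂_eq_splitSum`, `sum_unshuffles₃_eq_splitSumMid`). Fixing the first argument (`der`)
obeys a Leibniz rule for cup products and for `f ∘ D` (`der_hcup`, `der_star`). The identities are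
therefore proved for all degrees at once by induction on the list: the inductive step is bookkeeping
of signs, and the empty list is the axiom or elementary identity in arity `0`. -/

namespace HomotopyOOperator
noncomputable section

/-! ### Signed sums over the splittings of a list -/

section Split

variable {X : ℤ → Type*} {M : Type*} [AddCommGroup M]

/-- The sum of the degrees of the entries of a list. -/
def listDeg (L : List (Sigma X)) : ℤ := (L.map Sigma.fst).sum

@[simp] theorem listDeg_nil : listDeg ([] : List (Sigma X)) = 0 := rfl

@[simp] theorem listDeg_cons (v : Sigma X) (L : List (Sigma X)) :
    listDeg (v :: L) = v.1 + listDeg L := by simp [listDeg]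

/-- The sum of `± Φ A B` over the splittings of `L` into two complementary sublists `A`, `B`, with
Koszul signs. -/
def splitSum : (List (Sigma X) → List (Sigma X) → M) → List (Sigma X) → M
  | Φ, [] => Φ [] []
  -- The head joins the front of `A` at no cost; to reach the front of `B` it passes all of `A`.
  | Φ, v :: L => splitSum (fun A B => Φ (v :: A) B) L +
      splitSum (fun A B => Int.negOnePow (v.1 * listDeg A) • Φ A (v :: B)) L

/-- The sum of `± Φ A x B` over the splittings of `L` into two complementary sublists `A`, `B` and a
single entry `x`, with Koszul signs. -/
def splitSumMid : (List (Sigma X) → Sigma X → List (Sigma X) → M) → List (Sigma X) → M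
  | _, [] => 0
  | Φ, v :: L => splitSumMid (fun A x B => Φ (v :: A) x B) L +
      splitSum (fun A B => Int.negOnePow (v.1 * listDeg A) • Φ A v B) L +
      splitSumMid (fun A x B => Int.negOnePow (v.1 * (listDeg A + x.1)) • Φ A x (v :: B)) L

theorem splitSum_congr {Φ Ψ : List (Sigma X) → List (Sigma X) → M} {L : List (Sigma X)}
    (h : ∀ A B, listDeg A + listDeg B = listDeg L → Φ A B = Ψ A B) :
    splitSum Φ L = splitSum Ψ L := by
  induction L generalizing Φ Ψ with
  | nil => exact h _ _ rfl
  | cons v L ih =>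
    simp only [splitSum]
    congr 1
    · exact ih fun A B hAB => h _ _ (by simp [add_assoc, hAB])
    · exact ih fun A B hAB => by rw [h _ _ (by simp [← hAB]; ring)]

/-- The degree constraint is what identifies Koszul signs that are written through the degree of the
whole list and through those of its blocks. -/
theorem splitSumMid_congr {Φ Ψ : List (Sigma X) → Sigma X → List (Sigma X) → M}
    {L : List (Sigma X)}
    (h : ∀ A x B, listDeg A + x.1 + listDeg B = listDeg L → Φ A x B = Ψ A x B) :
    splitSumMid Φ L = splitSumMid Ψ L := by
  induction L generalizing Φ Ψ with
  | nil => rfl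
  | cons v L ih =>
    simp only [splitSumMid]
    congr 1
    · congr 1
      · exact ih fun A x B hAB => h _ _ _ (by simp [← hAB]; ring)
      · exact splitSum_congr fun A B hAB => by rw [h _ _ _ (by simp [← hAB]; ring)]
    · exact ih fun A x B hAB => by rw [h _ _ _ (by simp [← hAB]; ring)]

theorem splitSum_map {N F : Type*} [AddCommGroup N] [FunLike F M N] [AddMonoidHomClass F M N]
    (φ : F) (Φ : List (Sigma X) → List (Sigma X) → M) (L : List (Sigma X)) :
    φ (splitSum Φ L) = splitSum (fun A B => φ (Φ A B)) L := by
  induction L generalizing Φ with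
  | nil => rfl
  | cons v L ih => simp [splitSum, ih, Units.smul_def, map_zsmul]

theorem splitSumMid_map {N F : Type*} [AddCommGroup N] [FunLike F M N] [AddMonoidHomClass F M N]
    (φ : F) (Φ : List (Sigma X) → Sigma X → List (Sigma X) → M) (L : List (Sigma X)) :
    φ (splitSumMid Φ L) = splitSumMid (fun A x B => φ (Φ A x B)) L := by
  induction L generalizing Φ with
  | nil => simp [splitSumMid]
  | cons v L ih => simp [splitSumMid, ih, splitSum_map, Units.smul_def, map_zsmul]

theorem splitSum_add (Φ Ψ : List (Sigma X) → List (Sigma X) → M) (L : List (Sigma X)) :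
    splitSum (fun A B => Φ A B + Ψ A B) L = splitSum Φ L + splitSum Ψ L := by
  induction L generalizing Φ Ψ with
  | nil => rfl
  | cons v L ih => simp only [splitSum, smul_add, ih]; abel

theorem splitSum_units_smul (a : ℤˣ) (Φ : List (Sigma X) → List (Sigma X) → M)
    (L : List (Sigma X)) :
    splitSum (fun A B => a • Φ A B) L = a • splitSum Φ L :=
  (splitSum_map (DistribSMul.toAddMonoidHom M a) Φ L).symm

theorem splitSumMid_units_smul (a : ℤˣ) (Φ : List (Sigma X) → Sigma X → List (Sigma X) → M)
    (L : List (Sigma X)) :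
    splitSumMid (fun A x B => a • Φ A x B) L = a • splitSumMid Φ L :=
  (splitSumMid_map (DistribSMul.toAddMonoidHom M a) Φ L).symm

theorem splitSum_zero (L : List (Sigma X)) : splitSum (fun _ _ => (0 : M)) L = 0 :=
  (splitSum_map (0 : M →+ M) (fun _ _ => 0) L).symm

theorem splitSumMid_zero (L : List (Sigma X)) :
    splitSumMid (fun _ _ _ => (0 : M)) L = 0 :=
  (splitSumMid_map (0 : M →+ M) (fun _ _ _ => 0) L).symm

/-- Splitting off first the entries that do not belong to the first two blocks. -/
theorem splitSumMid_eq_splitSum (Φ : List (Sigma X) → Sigma X → List (Sigma X) → M)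
    (L : List (Sigma X)) :
    splitSumMid Φ L = splitSum (fun A B =>
      splitSumMid (fun A' x B' => if B' = [] then Φ A' x B else 0) A) L := by
  induction L generalizing Φ with
  | nil => rfl
  | cons v L ih =>
    simp only [splitSumMid, splitSum]
    simp only [List.cons_ne_nil, if_false, smul_zero, splitSumMid_zero, add_zero]
    rw [splitSum_add, ih, ih]
    congr 1
    · congr 1
      refine splitSum_congr fun A B _ => ?_
      clear ih
      rename_i h0
      clear h0
      generalize v.1 = d
      -- Here `v` is the single entry. As `B'` must be empty, only the splitting of `A` with `A' =
      -- A` survives.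
      suffices h : ∀ Ψ : List (Sigma X) → M, splitSum (fun A' B' => Int.negOnePow (d * listDeg A') •
          if B' = [] then Ψ A' else 0) A = Int.negOnePow (d * listDeg A) • Ψ A from
        (h fun A' => Φ A' v B).symm
      induction A generalizing Φ with
      | nil => simp [splitSum]
      | cons w A ih =>
        intro Ψ
        simp only [splitSum, List.cons_ne_nil, if_false, smul_zero, listDeg_cons, mul_add,
          Int.negOnePow_add, mul_smul, splitSum_units_smul]
        rw [ih Φ fun A' => Ψ (w :: A')]
        rw [add_eq_left]
        exact splitSum_zero A
    · refine splitSum_congr fun A B _ => ?_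
      rw [← splitSumMid_units_smul]
      -- When `B' = []`, the degree of `A` is that of `A'` plus that of `x`, so `v` passes the same
      -- total degree on both sides.
      refine splitSumMid_congr fun A' x B' h => ?_
      split_ifs with hB
      · subst hB
        rw [← h]; simp
      · simp

end Split

/-! ### Unshuffles as splittings of lists -/

section Unshuffle

/-- The permutation with `j ↦ 0` that is `σ` on the remaining positions and values. -/
def insPerm {p : ℕ} (j : Fin (p + 1)) (σ : Equiv.Perm (Fin p)) : Equiv.Perm (Fin (p + 1)) :=
  (finSuccEquiv' j).trans ((Equiv.optionCongr σ).trans (finSuccEquiv' 0).symm)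

@[simp] theorem insPerm_self {p : ℕ} (j : Fin (p + 1)) (σ : Equiv.Perm (Fin p)) :
    insPerm j σ j = 0 := by simp [insPerm]

@[simp] theorem insPerm_succAbove {p : ℕ} (j : Fin (p + 1)) (σ : Equiv.Perm (Fin p)) (i : Fin p) :
    insPerm j σ (j.succAbove i) = (σ i).succ := by simp [insPerm]

/-- The position `j` is the preimage of `0`, and `σ` is read off the other positions; surjectivity
is the count `(p + 1) * p! = (p + 1)!`. -/
theorem insPerm_bijective (p : ℕ) :
    Function.Bijective fun x : Fin (p + 1) × Equiv.Perm (Fin p) => insPerm x.1 x.2 := by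
  rw [Fintype.bijective_iff_injective_and_card]
  constructor
  · rintro ⟨j, σ⟩ ⟨j', σ'⟩ h
    have h : insPerm j σ = insPerm j' σ' := h
    obtain rfl : j = j' := (insPerm j' σ').injective (by rw [← h]; simp [h ▸ insPerm_self j' σ'])
    congr 1
    ext i
    have := congrArg (fun τ => τ (j.succAbove i)) h
    simpa [Fin.ext_iff] using this
  · simp [Fintype.card_perm, Nat.factorial_succ]

/-- The value `0` is the smallest, so in an unshuffle it must open its block. -/
theorem insPerm_mem_unshuffles {p : ℕ} (β : Fin (p + 1) → ℕ) (j : Fin (p + 1))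
    (σ : Equiv.Perm (Fin p)) :
    insPerm j σ ∈ unshuffles β ↔
      (∀ i < j, β i ≠ β j) ∧ σ ∈ unshuffles (fun i => β (j.succAbove i)) := by
  simp only [unshuffles, Finset.mem_filter, Finset.mem_univ, true_and]
  constructor
  · intro h
    refine ⟨fun i hi hβ => ?_, fun i k hik hβ => ?_⟩
    · have := h i j hi hβ
      simp at this
    · have := h _ _ (Fin.strictMono_succAbove j hik) hβ
      simpa using this
  · rintro ⟨h0, h⟩ i k hik hβ
    induction i using j.succAboveCases with
    | x =>
      induction k using j.succAboveCases with
      | x => exact absurd hik (lt_irrefl _)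
      | p k => simp
    | p i =>
      induction k using j.succAboveCases with
      | x => exact absurd hβ (h0 _ hik)
      | p k =>
        simpa using h i k ((Fin.strictMono_succAbove j).lt_iff_lt.mp hik) hβ

theorem sum_unshuffles_succ {M : Type*} [AddCommMonoid M] {p : ℕ} (β : Fin (p + 1) → ℕ)
    (Φ : Equiv.Perm (Fin (p + 1)) → M) :
    ∑ σ ∈ unshuffles β, Φ σ = ∑ j : Fin (p + 1), if (∀ i < j, β i ≠ β j) then
      ∑ σ ∈ unshuffles (fun i => β (j.succAbove i)), Φ (insPerm j σ) else 0 := by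
  classical
  have h : ∑ σ ∈ unshuffles β, Φ σ = ∑ σ, if σ ∈ unshuffles β then Φ σ else 0 := by
    rw [← Finset.sum_filter]; congr 1; ext; simp
  rw [h, ← (insPerm_bijective p).sum_comp, Fintype.sum_prod_type]
  refine Finset.sum_congr rfl fun j _ => ?_
  simp only [insPerm_mem_unshuffles]
  split_ifs with hj
  · simp only [and_iff_right hj]
    rw [← Finset.sum_filter]; congr 1; ext; simp
  · exact Finset.sum_eq_zero fun σ _ => if_neg fun h => hj h.1

theorem negOnePow_sum {ι : Type*} (s : Finset ι) (f : ι → ℤ) :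
    Int.negOnePow (∑ i ∈ s, f i) = ∏ i ∈ s, Int.negOnePow (f i) := by
  classical
  induction s using Finset.induction_on with
  | empty => simp
  | insert a s ha ih => rw [Finset.sum_insert ha, Finset.prod_insert ha, Int.negOnePow_add, ih]

variable {X : ℤ → Type*} {M : Type*} [AddCommGroup M]

theorem listDeg_take_ofFn {p : ℕ} (w : Fin p → Sigma X) (a : ℕ) :
    listDeg ((List.ofFn w).take a) = ∑ i : Fin p, if (i : ℕ) < a then (w i).1 else 0 := by
  rw [listDeg, List.map_take, List.map_ofFn, List.sum_take_ofFn, Finset.sum_filter]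
  rfl

/-- The inversions that involve the value `0` are exactly those with the positions before `j`. -/
theorem koszulSign_insPerm {p : ℕ} (j : Fin (p + 1)) (σ : Equiv.Perm (Fin p))
    (w : Fin (p + 1) → Sigma X) :
    koszulSign (insPerm j σ) (fun i => (w i).1) =
      Int.negOnePow ((w 0).1 * listDeg ((List.ofFn fun i => w (σ i).succ).take j)) *
        koszulSign σ (fun i => (w i.succ).1) := by
  rw [listDeg_take_ofFn, Finset.mul_sum, negOnePow_sum, koszulSign, koszulSign,
    Fin.prod_univ_succAbove _ j]
  simp only [Fin.prod_univ_succAbove (n := p) _ j, insPerm_self, insPerm_succAbove, Finset.prod_mul_distrib]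
  simp only [Fin.not_lt_zero, and_false, if_false, Finset.prod_const_one, one_mul]
  congr 1
  · refine Finset.prod_congr rfl fun i _ => ?_
    have : j.succAbove i < j ↔ (i : ℕ) < j := by
      rw [Fin.succAbove_lt_iff_castSucc_lt, Fin.lt_def]; rfl
    simp only [this, Fin.succ_pos, and_true]
    split_ifs
    · rw [mul_comm]
    · simp
  · refine Finset.prod_congr rfl fun i _ => Finset.prod_congr rfl fun k _ => ?_
    simp [Fin.succ_lt_succ_iff, (Fin.strictMono_succAbove j).lt_iff_lt]

theorem ofFn_insPerm {p : ℕ} (j : Fin (p + 1)) (σ : Equiv.Perm (Fin p))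
    (w : Fin (p + 1) → Sigma X) :
    List.ofFn (fun i => w (insPerm j σ i)) =
      (List.ofFn fun i => w (σ i).succ).insertIdx j (w 0) := by
  have hl : ((List.ofFn fun i => w (σ i).succ).insertIdx j (w 0)).length = p + 1 := by
    rw [List.length_insertIdx_of_le_length (by simp; omega)]; simp
  refine List.ext_getElem (by simp [hl]) fun n h1 h2 => ?_
  simp only [List.length_ofFn] at h1
  rw [List.getElem_insertIdx, List.getElem_ofFn]
  split_ifs with h3 h4
  · rw [List.getElem_ofFn]
    have : (⟨n, h1⟩ : Fin (p + 1)) = j.succAbove ⟨n, by omega⟩ := by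
      rw [Fin.succAbove_of_castSucc_lt _ _ (by simpa [Fin.lt_def] using h3)]; rfl
    rw [this, insPerm_succAbove]
  · have : (⟨n, h1⟩ : Fin (p + 1)) = j := Fin.ext h4
    rw [this, insPerm_self]
  · rw [List.getElem_ofFn]
    have : (⟨n, h1⟩ : Fin (p + 1)) = j.succAbove ⟨n - 1, by omega⟩ := by
      rw [Fin.succAbove_of_le_castSucc _ _ (by simp [Fin.le_def]; omega)]
      ext; simp; omega
    rw [this, insPerm_succAbove]

/-- Only the partition into blocks matters, so blocks may be relabelled after a position is deleted.
-/
theorem unshuffles_congr {p : ℕ} {β β' : Fin p → ℕ} (h : ∀ i j, i < j → (β i = β j ↔ β' i = β' j)) :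
    unshuffles β = unshuffles β' := by
  ext σ
  simp only [unshuffles, Finset.mem_filter, Finset.mem_univ, true_and]
  exact ⟨fun H i j hij hb => H i j hij ((h i j hij).2 hb),
    fun H i j hij hb => H i j hij ((h i j hij).1 hb)⟩

/-- The value `0` opens the first or the second block. The two guards discard an empty block; for `a
= 0` both starts are position `0`, which must be counted once. -/
theorem sum_unshuffles₂_succ {N : Type*} [AddCommMonoid N] {p a : ℕ} (ha : a ≤ p + 1)
    (Φ : Equiv.Perm (Fin (p + 1)) → N) :
    ∑ σ ∈ unshuffles₂ (p + 1) a, Φ σ =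
      (if 0 < a then ∑ σ ∈ unshuffles₂ p (a - 1), Φ (insPerm 0 σ) else 0) +
      (if h : a < p + 1 then ∑ σ ∈ unshuffles₂ p a, Φ (insPerm ⟨a, h⟩ σ) else 0) := by
  rw [unshuffles₂, sum_unshuffles_succ]
  have h1 : (if 0 < a then ∑ σ ∈ unshuffles₂ p (a - 1), Φ (insPerm 0 σ) else 0) =
      ∑ j : Fin (p + 1), if j = 0 then
        if 0 < a then ∑ σ ∈ unshuffles₂ p (a - 1), Φ (insPerm j σ) else 0 else 0 := by
    rw [Finset.sum_ite_eq' Finset.univ (0 : Fin (p + 1))]; simp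
  have h2 : (if h : a < p + 1 then ∑ σ ∈ unshuffles₂ p a, Φ (insPerm ⟨a, h⟩ σ) else 0) =
      ∑ j : Fin (p + 1), if (j : ℕ) = a then ∑ σ ∈ unshuffles₂ p a, Φ (insPerm j σ) else 0 := by
    split_ifs with h
    · rw [Finset.sum_eq_single (⟨a, h⟩ : Fin (p + 1))]
      · simp
      · intro b _ hb; rw [if_neg]; exact fun hh => hb (Fin.ext hh)
      · simp
    · exact (Finset.sum_eq_zero fun j _ => if_neg (by omega)).symm
  rw [h1, h2, ← Finset.sum_add_distrib]
  refine Finset.sum_congr rfl fun j _ => ?_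
  by_cases hja : (j : ℕ) = a
  · have hc : ¬ (j = 0 ∧ 0 < a) := by rintro ⟨rfl, h⟩; simp at hja; omega
    have hc' : (if j = 0 then if 0 < a then ∑ σ ∈ unshuffles₂ p (a - 1), Φ (insPerm j σ) else 0
        else 0) = 0 := by
      split_ifs with h1 h2
      · exact absurd ⟨h1, h2⟩ hc
      · rfl
      · rfl
    rw [hc', if_pos hja, zero_add, if_pos]
    · congr 1
      refine unshuffles_congr fun i k hik => ?_
      have e : ∀ i : Fin p, ((j.succAbove i : Fin (p + 1)) : ℕ) < a ↔ (i : ℕ) < a := by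
        intro i; rw [← hja, Fin.succAbove]; split_ifs with h <;> simp [Fin.lt_def] at h ⊢ <;> omega
      simp only [e]
    · intro i hi
      rw [Fin.lt_def] at hi
      rw [if_pos (by omega), if_neg (by omega)]; simp
  · rw [if_neg hja, add_zero]
    by_cases hj0 : j = 0
    · subst hj0
      have : 0 < a := by simp at hja; omega
      rw [if_pos (by simp), if_pos rfl, if_pos this]
      congr 1
      refine unshuffles_congr fun i k hik => ?_
      have e : ∀ i : Fin p, ((i.succ : Fin (p + 1)) : ℕ) < a ↔ (i : ℕ) < a - 1 := by
        intro i; simp; omega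
      simp only [Fin.zero_succAbove, e]
    · rw [if_neg hj0, if_neg]
      intro h
      have hj0' : 0 < (j : ℕ) := Nat.pos_of_ne_zero fun h => hj0 (Fin.ext h)
      have h00 : ((0 : Fin (p + 1)) : ℕ) = 0 := rfl
      by_cases hlt : (j : ℕ) < a
      · have := h 0 (Fin.lt_def.2 hj0')
        rw [if_pos hlt, if_pos (by rw [h00]; omega)] at this
        exact this rfl
      · have := h ⟨(j : ℕ) - 1, by omega⟩ (Fin.lt_def.2 (by simp; omega))
        rw [if_neg hlt, if_neg (by simp; omega)] at this
        exact this rfl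

/-- The three terms are the possible block starts `0`, `a` and `a + 1`. If `0` occupies the
singleton block, a two-block unshuffle of the rest remains. -/
theorem sum_unshuffles₃_succ {N : Type*} [AddCommMonoid N] {p a : ℕ} (ha : a < p + 1)
    (Φ : Equiv.Perm (Fin (p + 1)) → N) :
    ∑ σ ∈ unshuffles₃ (p + 1) a, Φ σ =
      (if 0 < a then ∑ σ ∈ unshuffles₃ p (a - 1), Φ (insPerm 0 σ) else 0) +
      (if h : a < p + 1 then ∑ σ ∈ unshuffles₂ p a, Φ (insPerm ⟨a, h⟩ σ) else 0) +
      (if h : a + 1 < p + 1 then ∑ σ ∈ unshuffles₃ p a, Φ (insPerm ⟨a + 1, h⟩ σ) else 0) := by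
  rw [unshuffles₃, sum_unshuffles_succ, dif_pos ha]
  have h1 : (if 0 < a then ∑ σ ∈ unshuffles₃ p (a - 1), Φ (insPerm 0 σ) else 0) =
      ∑ j : Fin (p + 1), if j = 0 ∧ 0 < a then
        ∑ σ ∈ unshuffles₃ p (a - 1), Φ (insPerm j σ) else 0 := by
    rw [Finset.sum_eq_single (0 : Fin (p + 1))]
    · simp
    · intro b _ hb; rw [if_neg]; exact fun hh => hb hh.1
    · simp
  have h2 : ∑ σ ∈ unshuffles₂ p a, Φ (insPerm ⟨a, ha⟩ σ) =
      ∑ j : Fin (p + 1), if (j : ℕ) = a then ∑ σ ∈ unshuffles₂ p a, Φ (insPerm j σ) else 0 := by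
    rw [Finset.sum_eq_single (⟨a, ha⟩ : Fin (p + 1))]
    · simp
    · intro b _ hb; rw [if_neg]; exact fun hh => hb (Fin.ext hh)
    · simp
  have h3 : (if h : a + 1 < p + 1 then ∑ σ ∈ unshuffles₃ p a, Φ (insPerm ⟨a + 1, h⟩ σ) else 0) =
      ∑ j : Fin (p + 1), if (j : ℕ) = a + 1 then ∑ σ ∈ unshuffles₃ p a, Φ (insPerm j σ)
        else 0 := by
    split_ifs with h
    · rw [Finset.sum_eq_single (⟨a + 1, h⟩ : Fin (p + 1))]
      · simp
      · intro b _ hb; rw [if_neg]; exact fun hh => hb (Fin.ext hh)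
      · simp
    · exact (Finset.sum_eq_zero fun j _ => if_neg (by omega)).symm
  rw [h1, h2, h3, ← Finset.sum_add_distrib, ← Finset.sum_add_distrib]
  refine Finset.sum_congr rfl fun j _ => ?_
  have hj0 : j = 0 ↔ (j : ℕ) = 0 := Fin.ext_iff
  have hs : ∀ i : Fin p, ((j.succAbove i : Fin (p + 1)) : ℕ) =
      if (i : ℕ) < j then (i : ℕ) else (i : ℕ) + 1 := by
    intro i; rw [Fin.succAbove]; split_ifs with h h' h' <;> simp [Fin.lt_def] at h ⊢ <;> omega
  rcases lt_trichotomy (j : ℕ) a with h | h | h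
  · rw [if_neg (α := N) (show ¬ (j : ℕ) = a by omega), if_neg (α := N) (show ¬ (j : ℕ) = a + 1 by omega), add_zero,
      add_zero]
    by_cases hj : (j : ℕ) = 0
    · rw [if_pos, if_pos ⟨hj0.2 hj, by omega⟩]
      · congr 1
        refine unshuffles_congr fun i k hik => ?_
        simp only [hs, hj, Nat.not_lt_zero, if_false]
        grind
      · intro i hi; rw [Fin.lt_def] at hi; omega
    · rw [if_neg, if_neg (by rw [hj0]; omega)]
      intro H
      have h00 : ((0 : Fin (p + 1)) : ℕ) = 0 := rfl
      have := H 0 (Fin.lt_def.2 (by rw [h00]; omega))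
      rw [if_pos h, if_pos (by rw [h00]; omega)] at this
      exact this rfl
  · rw [if_neg (α := N) (show ¬ (j = 0 ∧ 0 < a) by rw [hj0]; omega), if_pos (α := N) h,
      if_neg (α := N) (show ¬ (j : ℕ) = a + 1 by omega), add_zero, zero_add, if_pos]
    · congr 1
      refine unshuffles_congr fun i k hik => ?_
      simp only [hs, h]
      grind
    · intro i hi; rw [Fin.lt_def] at hi; grind
  · rw [if_neg (α := N) (show ¬ (j = 0 ∧ 0 < a) by rw [hj0]; omega),
      if_neg (α := N) (show ¬ (j : ℕ) = a by omega), zero_add, zero_add]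
    by_cases hj : (j : ℕ) = a + 1
    · rw [if_pos, if_pos hj]
      · congr 1
        refine unshuffles_congr fun i k hik => ?_
        simp only [hs, hj]
        grind
      · intro i hi; rw [Fin.lt_def] at hi; grind
    · rw [if_neg, if_neg hj]
      intro H
      have := H ⟨(j : ℕ) - 1, by omega⟩ (Fin.lt_def.2 (Nat.sub_lt (by omega) one_pos))
      grind

theorem take_insertIdx_self {α : Type*} (x : α) : ∀ (L : List α) (a : ℕ),
    (L.insertIdx a x).take a = L.take a
  | _, 0 => by simp
  | [], a + 1 => by simp
  | y :: L, a + 1 => by simp [take_insertIdx_self x L a]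

theorem drop_insertIdx_self {α : Type*} (x : α) : ∀ (L : List α) (a : ℕ), a ≤ L.length →
    (L.insertIdx a x).drop a = x :: L.drop a
  | _, 0, _ => by simp
  | [], a + 1, h => by simp at h
  | y :: L, a + 1, h => by simp [drop_insertIdx_self x L a (by simpa using h)]

/-- Sums over `(a, p - a)`-unshuffles as sums over splittings of a list. -/
theorem sum_unshuffles₂_eq_splitSum {p : ℕ} (w : Fin p → Sigma X)
    (Φ : List (Sigma X) → List (Sigma X) → M) :
    ∑ a ∈ Finset.range (p + 1), ∑ σ ∈ unshuffles₂ p a, koszulSign σ (fun i => (w i).1) •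
      Φ ((List.ofFn fun i => w (σ i)).take a) ((List.ofFn fun i => w (σ i)).drop a) =
    splitSum Φ (List.ofFn w) := by
  induction p generalizing Φ with
  | zero =>
    simp [unshuffles₂, unshuffles, koszulSign, splitSum]
  | succ p ih =>
    rw [List.ofFn_succ, splitSum, ← ih, ← ih]
    rw [Finset.sum_congr rfl fun a ha => sum_unshuffles₂_succ
      (Nat.lt_succ_iff.1 (Finset.mem_range.1 ha)) _, Finset.sum_add_distrib]
    congr 1
    -- Opening the first block lowers its size by one, so the index shifts and the term `a = 0`
    -- drops out; in the other branch the term `a = p + 1` drops out.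
    · rw [Finset.sum_range_succ' _ (p + 1)]
      simp only [lt_irrefl, if_false, add_zero, Nat.succ_pos, if_true, Nat.add_sub_cancel]
      refine Finset.sum_congr rfl fun a _ => Finset.sum_congr rfl fun σ _ => ?_
      rw [koszulSign_insPerm, ofFn_insPerm]
      simp
    · rw [Finset.sum_range_succ _ (p + 1)]
      simp only [lt_irrefl, dif_neg, not_false_eq_true, add_zero]
      refine Finset.sum_congr rfl fun a ha => ?_
      rw [dif_pos (Finset.mem_range.1 ha)]
      refine Finset.sum_congr rfl fun σ _ => ?_
      rw [koszulSign_insPerm, ofFn_insPerm]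
      simp only
      rw [take_insertIdx_self, drop_insertIdx_self _ _ _ (by
        have := Finset.mem_range.1 ha; simp; omega), smul_smul, mul_comm]

/-- `Φ` applied to the first `a` entries, the next one, and the remaining ones. -/
def splitAtMid (Φ : List (Sigma X) → Sigma X → List (Sigma X) → M) (a : ℕ)
    (L : List (Sigma X)) : M :=
  match L.drop a with
  -- Default value for `a` at least the length; the unshuffle sums have `a < p` and never meet it.
  | [] => 0
  | x :: B => Φ (L.take a) x B

/-- Put at index `a + 1`, the vector `v` opens the last block, having passed the first block and the
middle entry. -/
theorem splitAtMid_insertIdx_succ (v : Sigma X) :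
    ∀ (Φ : List (Sigma X) → Sigma X → List (Sigma X) → M) (L : List (Sigma X)) (a : ℕ),
    a < L.length → Int.negOnePow (v.1 * listDeg (L.take (a + 1))) •
      splitAtMid Φ a (L.insertIdx (a + 1) v) =
    splitAtMid (fun A x B => Int.negOnePow (v.1 * (listDeg A + x.1)) • Φ A x (v :: B)) a L
  | Φ, x :: L, 0, _ => by simp [splitAtMid]
  | Φ, [], a, h => by simp at h
  | Φ, y :: L, a + 1, h => by
    have := splitAtMid_insertIdx_succ v (fun A x B => Int.negOnePow (v.1 * y.1) • Φ (y :: A) x B)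
      L a (by simpa using h)
    simp only [splitAtMid, List.insertIdx_succ_cons, List.drop_succ_cons, List.take_succ_cons,
      listDeg_cons, mul_add, Int.negOnePow_add] at this ⊢
    cases hL : L.drop a with
    | nil => simp only [List.drop_eq_nil_iff] at hL; simp at h; omega
    | cons z B =>
      cases hL' : (L.insertIdx (a + 1) v).drop a with
      | nil => simp [hL'] at this ⊢; simpa [hL, smul_smul, mul_assoc, mul_comm, mul_left_comm] using this
      | cons z' B' =>
        simpa [hL, hL', smul_smul, mul_assoc, mul_comm, mul_left_comm] using this

/-- Sums over `(a, 1, p - a - 1)`-unshuffles as sums over splittings of a list. -/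
theorem sum_unshuffles₃_eq_splitSumMid {p : ℕ} (w : Fin p → Sigma X)
    (Φ : List (Sigma X) → Sigma X → List (Sigma X) → M) :
    ∑ a ∈ Finset.range p, ∑ σ ∈ unshuffles₃ p a, koszulSign σ (fun i => (w i).1) •
      splitAtMid Φ a (List.ofFn fun i => w (σ i)) =
    splitSumMid Φ (List.ofFn w) := by
  induction p generalizing Φ with
  | zero => simp [splitSumMid]
  | succ p ih =>
    rw [List.ofFn_succ, splitSumMid, ← ih, ← ih, ← sum_unshuffles₂_eq_splitSum]
    rw [Finset.sum_congr rfl fun a ha => sum_unshuffles₃_succ (Finset.mem_range.1 ha) _,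
      Finset.sum_add_distrib, Finset.sum_add_distrib]
    congr 1
    · congr 1
      · rw [Finset.sum_range_succ' _ p]
        simp only [lt_irrefl, if_false, add_zero, Nat.succ_pos, if_true, Nat.add_sub_cancel]
        refine Finset.sum_congr rfl fun a _ => Finset.sum_congr rfl fun σ _ => ?_
        rw [koszulSign_insPerm, ofFn_insPerm]
        simp [splitAtMid]
      · refine Finset.sum_congr rfl fun a ha => ?_
        rw [dif_pos (Finset.mem_range.1 ha)]
        refine Finset.sum_congr rfl fun σ _ => ?_
        rw [koszulSign_insPerm, ofFn_insPerm]
        simp only [splitAtMid]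
        rw [take_insertIdx_self, drop_insertIdx_self _ _ _ (by
          have := Finset.mem_range.1 ha; simp; omega), smul_smul, mul_comm]
    · rw [Finset.sum_range_succ _ p]
      simp only [lt_irrefl, dif_neg, not_false_eq_true, add_zero]
      refine Finset.sum_congr rfl fun a ha => ?_
      have ha' := Finset.mem_range.1 ha
      rw [dif_pos (by omega)]
      refine Finset.sum_congr rfl fun σ _ => ?_
      rw [koszulSign_insPerm, ofFn_insPerm, mul_comm, mul_smul]
      simp only
      rw [splitAtMid_insertIdx_succ _ _ _ _ (by simpa using ha')]

end Unshuffle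

/-! ### Sequences of multilinear maps on lists of homogeneous vectors -/

section Eval

variable {K : Type*} [Field K] {V W W₁ W₂ W₃ : Type*} [AddCommGroup V] [Module K V]
  [AddCommGroup W] [Module K W] [AddCommGroup W₁] [Module K W₁] [AddCommGroup W₂] [Module K W₂]
  [AddCommGroup W₃] [Module K W₃] {𝒱 : ℤ → Submodule K V}

/-- Homogeneous vectors together with a degree. -/
abbrev Homog (𝒱 : ℤ → Submodule K V) : Type _ := Sigma fun i : ℤ => 𝒱 i

/-- The value of a sequence of multilinear maps on a list of homogeneous vectors. -/
def ev (f : MultiSeq K V W) (L : List (Homog 𝒱)) : W :=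
  f L.length fun i => ((L.get i).2 : V)

/-- Arity and list length are often only propositionally equal; comparing entries one by one avoids
casts. -/
theorem ev_eq (f : MultiSeq K V W) {L : List (Homog 𝒱)} {k : ℕ} (h : L.length = k)
    (w : Fin k → Homog 𝒱) (hw : ∀ (i : ℕ) (hi : i < k), L[i]'(h ▸ hi) = w ⟨i, hi⟩) :
    f k (fun i => ((w i).2 : V)) = ev f L := by
  subst h
  obtain rfl : w = L.get := funext fun i => (hw i i.2).symm
  rfl

theorem ev_ofFn (f : MultiSeq K V W) {k : ℕ} (w : Fin k → Homog 𝒱) :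
    ev f (List.ofFn w) = f k fun i => ((w i).2 : V) :=
  (ev_eq f (by simp) _ fun i hi => by simp).symm

@[simp] theorem ev_add (f g : MultiSeq K V W) (L : List (Homog 𝒱)) :
    ev (f + g) L = ev f L + ev g L := rfl

@[simp] theorem ev_sub (f g : MultiSeq K V W) (L : List (Homog 𝒱)) :
    ev (f - g) L = ev f L - ev g L := rfl

@[simp] theorem ev_smul (a : K) (f : MultiSeq K V W) (L : List (Homog 𝒱)) :
    ev (a • f) L = a • ev f L := rfl

@[simp] theorem ev_units_smul (a : ℤˣ) (f : MultiSeq K V W) (L : List (Homog 𝒱)) :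
    ev (a • f) L = a • ev f L := rfl

/-- Insertion of `v` as the first argument. -/
def der (v : Homog 𝒱) (f : MultiSeq K V W) : MultiSeq K V W :=
  fun k => (f (k + 1)).curryLeft v.2

/-- This drives all the later inductions: removing the head of the list replaces `f` by `der v f`.
-/
theorem ev_cons (v : Homog 𝒱) (f : MultiSeq K V W) (L : List (Homog 𝒱)) :
    ev f (v :: L) = ev (der v f) L := by
  refine congrArg (f (L.length + 1)) (funext fun i => ?_)
  induction i using Fin.cases <;> rfl

@[simp] theorem der_add (v : Homog 𝒱) (f g : MultiSeq K V W) :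
    der v (f + g) = der v f + der v g := rfl

@[simp] theorem der_units_smul (v : Homog 𝒱) (a : ℤˣ) (f : MultiSeq K V W) :
    der v (a • f) = a • der v f := rfl

/-- Composition of a sequence of multilinear maps with a linear map. -/
def mapSeq (φ : W →ₗ[K] W₁) (f : MultiSeq K V W) : MultiSeq K V W₁ :=
  fun k => φ.compMultilinearMap (f k)

@[simp] theorem ev_mapSeq (φ : W →ₗ[K] W₁) (f : MultiSeq K V W) (L : List (Homog 𝒱)) :
    ev (mapSeq φ f) L = φ (ev f L) := rfl

@[simp] theorem der_mapSeq (v : Homog 𝒱) (φ : W →ₗ[K] W₁) (f : MultiSeq K V W) :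
    der v (mapSeq φ f) = mapSeq φ (der v f) := rfl

/-- The first argument separated from the others. -/
def curry (f : MultiSeq K V W) : MultiSeq K V (V →ₗ[K] W) := fun k =>
  { toFun := fun T =>
      { toFun := fun x => (f (k + 1)).curryLeft x T
        map_add' := fun x y => by simp
        map_smul' := fun a x => by simp }
    map_update_add' := fun T i x y => by
      ext z; exact ((f (k + 1)).curryLeft z).map_update_add T i x y
    map_update_smul' := fun T i a x => by
      ext z; exact ((f (k + 1)).curryLeft z).map_update_smul T i a x }

theorem ev_curry_homog (f : MultiSeq K V W) (x : Homog 𝒱) (L : List (Homog 𝒱)) :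
    ev (curry f) L (x.2 : V) = ev f (x :: L) := (ev_cons x f L).symm

/-- A value such as `ev h A` thereby becomes a list entry, to which graded symmetry and `der` apply.
-/
theorem ev_curry_of_mem (f : MultiSeq K V W) {d : ℤ} {x : V} (hx : x ∈ 𝒱 d)
    (L : List (Homog 𝒱)) :
    ev (curry f) L x = ev f ((⟨d, x, hx⟩ : Homog 𝒱) :: L) :=
  ev_curry_homog f ⟨d, x, hx⟩ L

/-- The projection `S(V) → V`. -/
def prSeq : MultiSeq K V V := fun k =>
  match k with
  | 1 => MultilinearMap.ofSubsingleton K V V 0 LinearMap.id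
  | _ => 0

@[simp] theorem ev_prSeq_nil : ev (prSeq : MultiSeq K V V) ([] : List (Homog 𝒱)) = 0 := rfl

@[simp] theorem ev_prSeq_single (x : Homog 𝒱) :
    ev (prSeq : MultiSeq K V V) [x] = (x.2 : V) := rfl

@[simp] theorem ev_prSeq_cons_cons (x y : Homog 𝒱) (L : List (Homog 𝒱)) :
    ev (prSeq : MultiSeq K V V) (x :: y :: L) = 0 := rfl

variable [DirectSum.Decomposition 𝒱]

/-- Homogeneous vectors span `V`; they are reached one argument at a time by currying. -/
theorem multilinearMap_ext_homog {k : ℕ} {f g : MultilinearMap K (fun _ : Fin k => V) W}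
    (h : ∀ w : Fin k → Homog 𝒱, f (fun i => ((w i).2 : V)) = g fun i => ((w i).2 : V)) :
    f = g := by
  induction k with
  | zero =>
    ext v
    have := h fun i => i.elim0
    rwa [Subsingleton.elim (fun i => _) v] at this
  | succ k ih =>
    suffices ∀ x, f.curryLeft x = g.curryLeft x by
      ext v
      have := congrArg (fun φ => φ (Fin.tail v)) (this (v 0))
      simpa using this
    intro x
    induction x using DirectSum.Decomposition.inductionOn 𝒱 with
    | zero => simp
    | homogeneous m =>
      rename_i i
      refine ih fun w => ?_
      have := h (Fin.cons (⟨i, m⟩ : Homog 𝒱) w)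
      have e : (fun j => (((Fin.cons (⟨i, m⟩ : Homog 𝒱) w : Fin (k + 1) → Homog 𝒱) j).2 : V)) =
          Fin.cons (m : V) fun j => ((w j).2 : V) := by
        funext j
        induction j using Fin.cases <;> rfl
      rwa [e] at this
    | add a b ha hb => rw [map_add, map_add, ha, hb]

variable (𝒱) in
theorem multiSeq_ext {f g : MultiSeq K V W} (h : ∀ L : List (Homog 𝒱), ev f L = ev g L) :
    f = g := by
  funext k
  refine multilinearMap_ext_homog (𝒱 := 𝒱) fun w => ?_
  rw [← ev_ofFn, ← ev_ofFn, h]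

theorem ev_cup (B : W →ₗ[K] W →ₗ[K] W) (n : ℤ) (f g : MultiSeq K V W) (L : List (Homog 𝒱)) :
    ev (cup 𝒱 B n f g) L = splitSum (fun A A' =>
      Int.negOnePow (n * listDeg A) • B (ev f A) (ev g A')) L := by
  obtain ⟨p, w, rfl⟩ : ∃ (p : ℕ) (w : Fin p → Homog 𝒱), L = List.ofFn w :=
    ⟨L.length, L.get, (List.ofFn_get L).symm⟩
  -- `cup` is indexed by the size of the second block and the splitting sum by that of the first,
  -- hence the reflection of the range.
  rw [ev_ofFn, cup_apply 𝒱 B n f g (d := fun i => (w i).1) (fun i => (w i).2.2),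
    ← sum_unshuffles₂_eq_splitSum, ← Finset.sum_range_reflect, ← Fin.sum_univ_eq_sum_range
      (fun l => ∑ σ ∈ unshuffles₂ p (p + 1 - 1 - l), koszulSign σ (fun i => (w i).1) •
        Int.negOnePow (n * listDeg ((List.ofFn fun i => w (σ i)).take (p + 1 - 1 - l))) •
        B (ev f ((List.ofFn fun i => w (σ i)).take (p + 1 - 1 - l)))
          (ev g ((List.ofFn fun i => w (σ i)).drop (p + 1 - 1 - l)))) (p + 1)]
  refine Finset.sum_congr rfl fun l _ => Finset.sum_congr rfl fun σ _ => ?_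
  simp only [Nat.add_sub_cancel]
  have hl : p - (p - (l : ℕ)) = l := by omega
  rw [smul_smul, mul_comm]
  congr 2
  · congr 3
    rw [listDeg, List.map_take, List.map_ofFn, List.sum_take_ofFn, Finset.sum_filter]
    have : ∀ (q : ℕ) (hq : q ≤ p) (F : Fin p → ℤ), (∑ i : Fin q, F ⟨i, by omega⟩) =
        ∑ j : Fin p, if (j : ℕ) < q then F j else 0 := by
      intro q hq F
      obtain ⟨r, rfl⟩ := Nat.exists_eq_add_of_le hq
      rw [Fin.sum_univ_add]
      simp [Fin.castAdd, Fin.castLE]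
    exact this (p - l) (by omega) fun j => (w (σ j)).1
  · rw [← ev_eq f (L := (List.ofFn fun i => w (σ i)).take (p - l)) (by simp)
        (fun i : Fin (p - l) => w (σ ⟨i, by omega⟩)) fun i hi => by simp]
  · rw [← ev_eq g (L := (List.ofFn fun i => w (σ i)).drop (p - l)) (by simp [hl])
        (fun i : Fin l => w (σ ⟨p - l + i, by omega⟩)) fun i hi => by simp]

theorem ev_insertion (f : MultiSeq K V W) (G : MultiSeq K V (Module.End K V))
    (L : List (Homog 𝒱)) :
    ev (insertion 𝒱 f G) L = splitSumMid (fun A x B => ev (curry f) B (ev G A (x.2 : V))) L := by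
  obtain ⟨p, w, rfl⟩ : ∃ (p : ℕ) (w : Fin p → Homog 𝒱), L = List.ofFn w :=
    ⟨L.length, L.get, (List.ofFn_get L).symm⟩
  rw [ev_ofFn, insertion_apply 𝒱 f G (d := fun i => (w i).1) (fun i => (w i).2.2),
    ← sum_unshuffles₃_eq_splitSumMid, ← Fin.sum_univ_eq_sum_range
      (fun a => ∑ σ ∈ unshuffles₃ p a, koszulSign σ (fun i => (w i).1) •
      splitAtMid (fun A x B => ev (curry f) B (ev G A (x.2 : V))) a
        (List.ofFn fun i => w (σ i))) p]
  refine Finset.sum_congr rfl fun l _ => Finset.sum_congr rfl fun σ _ => ?_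
  congr 1
  have hd : (List.ofFn fun i => w (σ i)).drop l =
      w (σ l) :: (List.ofFn fun i => w (σ i)).drop (l + 1) := by
    rw [List.drop_eq_getElem_cons (by simp)]; simp
  rw [splitAtMid, hd]
  simp only
  rw [← ev_eq G (L := (List.ofFn fun i => w (σ i)).take l) (by simp)
      (fun i : Fin l => w (σ ⟨i, by omega⟩)) fun i hi => by simp,
    ← ev_eq (curry f) (k := p - 1 - l) (by simp; omega)
      (fun i => w (σ ⟨l + 1 + i, by omega⟩)) fun i hi => by simp]
  rfl

/-! ### Cup products between different spaces, and composition with coderivations -/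

/-- The bilinear map `W₁ × W₂ → W₃` as an operation on `W₁ × W₂ × W₃`. -/
def extendBilin (B : W₁ →ₗ[K] W₂ →ₗ[K] W₃) :
    (W₁ × W₂ × W₃) →ₗ[K] (W₁ × W₂ × W₃) →ₗ[K] (W₁ × W₂ × W₃) :=
  (B.compl₁₂ (LinearMap.fst K W₁ (W₂ × W₃))
    (LinearMap.fst K W₂ W₃ ∘ₗ LinearMap.snd K W₁ (W₂ × W₃))).compr₂
    (LinearMap.inr K W₁ (W₂ × W₃) ∘ₗ LinearMap.inr K W₂ W₃)

variable (𝒱) in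
/-- The cup product along a bilinear map between three different spaces. -/
def hcup (B : W₁ →ₗ[K] W₂ →ₗ[K] W₃) (n : ℤ) (f : MultiSeq K V W₁) (g : MultiSeq K V W₂) :
    MultiSeq K V W₃ :=
  mapSeq (LinearMap.snd K W₂ W₃ ∘ₗ LinearMap.snd K W₁ (W₂ × W₃))
    (cup 𝒱 (extendBilin B) n (mapSeq (LinearMap.inl K W₁ (W₂ × W₃)) f)
      (mapSeq (LinearMap.inr K W₁ (W₂ × W₃) ∘ₗ LinearMap.inl K W₂ W₃) g))

/-- The product space only serves to fit the one-space format of `cup`: the factors occupy the first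
two components, and the value is read off the third. -/
theorem ev_hcup (B : W₁ →ₗ[K] W₂ →ₗ[K] W₃) (n : ℤ) (f : MultiSeq K V W₁)
    (g : MultiSeq K V W₂) (L : List (Homog 𝒱)) :
    ev (hcup 𝒱 B n f g) L = splitSum (fun A A' =>
      Int.negOnePow (n * listDeg A) • B (ev f A) (ev g A')) L := by
  rw [hcup, ev_mapSeq, ev_cup, splitSum_map]
  simp [extendBilin, Units.smul_def]

theorem cup_eq_hcup (B : W →ₗ[K] W →ₗ[K] W) (n : ℤ) (f g : MultiSeq K V W) :
    cup 𝒱 B n f g = hcup 𝒱 B n f g :=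
  multiSeq_ext 𝒱 fun L => by rw [ev_cup, ev_hcup]

@[simp] theorem ev_hcup_nil (B : W₁ →ₗ[K] W₂ →ₗ[K] W₃) (n : ℤ) (f : MultiSeq K V W₁)
    (g : MultiSeq K V W₂) :
    ev (hcup 𝒱 B n f g) ([] : List (Homog 𝒱)) =
      B (ev f ([] : List (Homog 𝒱))) (ev g ([] : List (Homog 𝒱))) := by
  rw [ev_hcup]; simp [splitSum]

/-- If `v` goes to `g`, it passes all of `A`; that sign is absorbed by raising `n` to `n + v.1`,
just as the degree of `g` changes under `der v`. -/
theorem der_hcup (v : Homog 𝒱) (B : W₁ →ₗ[K] W₂ →ₗ[K] W₃) (n : ℤ) (f : MultiSeq K V W₁)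
    (g : MultiSeq K V W₂) :
    der v (hcup 𝒱 B n f g) =
      Int.negOnePow (n * v.1) • hcup 𝒱 B n (der v f) g + hcup 𝒱 B (n + v.1) f (der v g) := by
  refine multiSeq_ext 𝒱 fun L => ?_
  rw [← ev_cons, ev_hcup, splitSum, ev_add, ev_units_smul, ev_hcup, ev_hcup,
    ← splitSum_units_smul]
  congr 1
  · refine splitSum_congr fun A A' _ => ?_
    rw [listDeg_cons, mul_add, Int.negOnePow_add, mul_smul, ev_cons]
  · refine splitSum_congr fun A A' _ => ?_
    rw [add_mul, add_comm, Int.negOnePow_add, mul_smul, ev_cons]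

theorem hcup_add_left (B : W₁ →ₗ[K] W₂ →ₗ[K] W₃) (n : ℤ) (f f' : MultiSeq K V W₁)
    (g : MultiSeq K V W₂) : hcup 𝒱 B n (f + f') g = hcup 𝒱 B n f g + hcup 𝒱 B n f' g :=
  multiSeq_ext 𝒱 fun L => by simp only [ev_hcup, ev_add, map_add, LinearMap.add_apply, smul_add,
    splitSum_add]

theorem hcup_add_right (B : W₁ →ₗ[K] W₂ →ₗ[K] W₃) (n : ℤ) (f : MultiSeq K V W₁)
    (g g' : MultiSeq K V W₂) : hcup 𝒱 B n f (g + g') = hcup 𝒱 B n f g + hcup 𝒱 B n f g' :=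
  multiSeq_ext 𝒱 fun L => by simp only [ev_hcup, ev_add, map_add, smul_add, splitSum_add]

theorem hcup_smul_left (B : W₁ →ₗ[K] W₂ →ₗ[K] W₃) (n : ℤ) (a : K) (f : MultiSeq K V W₁)
    (g : MultiSeq K V W₂) : hcup 𝒱 B n (a • f) g = a • hcup 𝒱 B n f g :=
  multiSeq_ext 𝒱 fun L => by
    simp only [ev_hcup, ev_smul, map_smul, LinearMap.smul_apply]
    rw [show a • splitSum _ L = (a • LinearMap.id : W₃ →ₗ[K] W₃) (splitSum _ L) from rfl,
      splitSum_map]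
    exact splitSum_congr fun A A' _ => smul_comm _ _ _

theorem hcup_smul_right (B : W₁ →ₗ[K] W₂ →ₗ[K] W₃) (n : ℤ) (a : K) (f : MultiSeq K V W₁)
    (g : MultiSeq K V W₂) : hcup 𝒱 B n f (a • g) = a • hcup 𝒱 B n f g :=
  multiSeq_ext 𝒱 fun L => by
    simp only [ev_hcup, ev_smul, map_smul]
    rw [show a • splitSum _ L = (a • LinearMap.id : W₃ →ₗ[K] W₃) (splitSum _ L) from rfl,
      splitSum_map]
    exact splitSum_congr fun A A' _ => smul_comm _ _ _

theorem units_smul_eq_smul {M : Type*} [AddCommGroup M] [Module K M] (a : ℤˣ) (x : M) :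
    a • x = ((a : ℤ) : K) • x := by rw [Units.smul_def, Int.cast_smul_eq_zsmul]

theorem hcup_units_smul_left (B : W₁ →ₗ[K] W₂ →ₗ[K] W₃) (n : ℤ) (a : ℤˣ) (f : MultiSeq K V W₁)
    (g : MultiSeq K V W₂) : hcup 𝒱 B n (a • f) g = a • hcup 𝒱 B n f g := by
  rw [units_smul_eq_smul (K := K), hcup_smul_left, ← units_smul_eq_smul]

theorem hcup_units_smul_right (B : W₁ →ₗ[K] W₂ →ₗ[K] W₃) (n : ℤ) (a : ℤˣ) (f : MultiSeq K V W₁)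
    (g : MultiSeq K V W₂) : hcup 𝒱 B n f (a • g) = a • hcup 𝒱 B n f g := by
  rw [units_smul_eq_smul (K := K), hcup_smul_right, ← units_smul_eq_smul]

variable (𝒱) in
/-- The composition of `f` with the coderivation of `S(V)` that is given by `h : S(V) → V`. -/
def star (f : MultiSeq K V W) (h : MultiSeq K V V) : MultiSeq K V W :=
  hcup 𝒱 (LinearMap.id : (V →ₗ[K] W) →ₗ[K] V →ₗ[K] W).flip 0 h (curry f)

theorem ev_star (f : MultiSeq K V W) (h : MultiSeq K V V) (L : List (Homog 𝒱)) :
    ev (star 𝒱 f h) L = splitSum (fun A B => ev (curry f) B (ev h A)) L := by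
  rw [star, ev_hcup]
  simp

variable (𝒱) in
/-- The corestriction to `V` of the coderivation of `S(V)` that is given by `G`. -/
def corestr (G : MultiSeq K V (Module.End K V)) : MultiSeq K V V :=
  hcup 𝒱 (LinearMap.id : Module.End K V →ₗ[K] V →ₗ[K] V) 0 G prSeq

theorem ev_corestr (G : MultiSeq K V (Module.End K V)) (L : List (Homog 𝒱)) :
    ev (corestr 𝒱 G) L =
      splitSumMid (fun A x B => if B = [] then ev G A (x.2 : V) else 0) L := by
  rw [corestr, ev_hcup]
  simp only [zero_mul, Int.negOnePow_zero, one_smul, LinearMap.id_apply]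
  -- The recursion replaces `G` by its values on `v :: A`, so the induction runs over arbitrary
  -- functions of lists.
  generalize ev G = Ψ
  induction L generalizing Ψ with
  | nil => simp [splitSum, splitSumMid]
  | cons v L ih =>
    simp only [splitSum, splitSumMid, List.cons_ne_nil, if_false, smul_zero, splitSumMid_zero,
      add_zero]
    congr 1
    · exact ih fun A => Ψ (v :: A)
    · refine splitSum_congr fun A B _ => ?_
      cases B <;> simp

/-- Choose first the entries used by `G` together with the vector it acts on, then split off that
vector as the last of them. The first choice is `f ∘ D`, the second is `corestr`. -/
theorem insertion_eq_star (f : MultiSeq K V W) (G : MultiSeq K V (Module.End K V)) :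
    insertion 𝒱 f G = star 𝒱 f (corestr 𝒱 G) :=
  multiSeq_ext 𝒱 fun L => by
    rw [ev_insertion, splitSumMid_eq_splitSum, ev_star]
    refine splitSum_congr fun A B _ => ?_
    rw [ev_corestr, splitSumMid_map]
    refine splitSumMid_congr fun A' x B' _ => ?_
    split_ifs <;> simp

end Eval

/-! ### Graded symmetry and degree on lists -/

section Symmetry

variable {K : Type*} [Field K] {V W W₁ W₂ W₃ : Type*} [AddCommGroup V] [Module K V]
  [AddCommGroup W] [Module K W] [AddCommGroup W₁] [Module K W₁] [AddCommGroup W₂] [Module K W₂]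
  [AddCommGroup W₃] [Module K W₃] {𝒱 : ℤ → Submodule K V}

variable (𝒱) in
/-- Graded symmetry under transpositions of neighbours. -/
def IsGSymm (f : MultiSeq K V W) : Prop :=
  ∀ (P L : List (Homog 𝒱)) (v w : Homog 𝒱),
    ev f (P ++ v :: w :: L) = Int.negOnePow (v.1 * w.1) • ev f (P ++ w :: v :: L)

variable (𝒱) in
/-- The sequence `f` raises degrees by `n`. -/
def HasDeg (𝒲 : ℤ → Submodule K W) (n : ℤ) (f : MultiSeq K V W) : Prop :=
  ∀ L : List (Homog 𝒱), ev f L ∈ 𝒲 (n + listDeg L)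

theorem IsGSymm.der {f : MultiSeq K V W} (hf : IsGSymm 𝒱 f) (v : Homog 𝒱) :
    IsGSymm 𝒱 (der v f) := by
  intro P L x y
  rw [← ev_cons, ← ev_cons]
  exact hf (v :: P) L x y

theorem HasDeg.der {𝒲 : ℤ → Submodule K W} {n : ℤ} {f : MultiSeq K V W} (hf : HasDeg 𝒱 𝒲 n f)
    (v : Homog 𝒱) : HasDeg 𝒱 𝒲 (n + v.1) (der v f) := by
  intro L
  have := hf (v :: L)
  rwa [ev_cons, listDeg_cons, ← add_assoc] at this

theorem HasDeg.ev_nil_mem {𝒲 : ℤ → Submodule K W} {n : ℤ} {f : MultiSeq K V W}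
    (hf : HasDeg 𝒱 𝒲 n f) : ev f ([] : List (Homog 𝒱)) ∈ 𝒲 n := by
  simpa using hf []

theorem IsGSymm.ev_insertIdx {f : MultiSeq K V W} (hf : IsGSymm 𝒱 f) (x : Homog 𝒱)
    (M : List (Homog 𝒱)) (j : ℕ) (hj : j ≤ M.length) :
    ev f (x :: M) = Int.negOnePow (x.1 * listDeg (M.take j)) • ev f (M.insertIdx j x) := by
  induction j generalizing M f with
  | zero => simp
  | succ j ih =>
    cases M with
    | nil => simp at hj
    | cons y M =>
      have h1 := hf [] M x y
      simp only [List.nil_append] at h1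
      rw [h1, ev_cons y, ih (hf.der y) M (by simpa using hj), smul_smul, ← Int.negOnePow_add,
        List.take_succ_cons, listDeg_cons, mul_add, List.insertIdx_succ_cons, ev_cons y]

theorem koszulSign_one {p : ℕ} (d : Fin p → ℤ) : koszulSign 1 d = 1 := by
  refine Finset.prod_eq_one fun i _ => Finset.prod_eq_one fun j _ => if_neg ?_
  rintro ⟨h1, h2⟩
  exact lt_asymm h1 h2

/-- The transposition is assembled from `insPerm` along the prefix `P`, so that `koszulSign_insPerm`
computes its sign. -/
theorem exists_koszulSign_eq_negOnePow {X : ℤ → Type*} (P R : List (Sigma X)) (v x : Sigma X)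
    {p : ℕ} (w : Fin p → Sigma X) (hw : List.ofFn w = P ++ v :: x :: R) :
    ∃ σ : Equiv.Perm (Fin p), List.ofFn (fun i => w (σ i)) = P ++ x :: v :: R ∧
      koszulSign σ (fun i => (w i).1) = Int.negOnePow (v.1 * x.1) := by
  induction P generalizing p with
  | nil =>
    obtain _ | _ | p := p
    · simp at hw
    · simp at hw
    rw [List.ofFn_succ, List.ofFn_succ, List.nil_append, List.cons.injEq, List.cons.injEq] at hw
    obtain ⟨rfl, rfl, rfl⟩ := hw
    refine ⟨insPerm 1 1, ?_, ?_⟩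
    · rw [ofFn_insPerm]; simp [List.ofFn_succ]
    · rw [koszulSign_insPerm, koszulSign_one]; simp [List.ofFn_succ]
  | cons u P ih =>
    obtain _ | p := p
    · simp at hw
    rw [List.ofFn_succ, List.cons_append, List.cons.injEq] at hw
    obtain ⟨rfl, hw⟩ := hw
    obtain ⟨σ, h1, h2⟩ := ih _ hw
    refine ⟨insPerm 0 σ, ?_, ?_⟩
    · rw [ofFn_insPerm]; simp [h1]
    · rw [koszulSign_insPerm, h2]; simp

/-- Neighbour transpositions generate: the head is moved to position `j` by `IsGSymm.ev_insertIdx`,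
and the rest is permuted by induction on `der`. -/
theorem IsGSymm.apply_perm {f : MultiSeq K V W} (hf : IsGSymm 𝒱 f) {p : ℕ} (w : Fin p → Homog 𝒱)
    (σ : Equiv.Perm (Fin p)) :
    ev f (List.ofFn w) =
      koszulSign σ (fun i => (w i).1) • ev f (List.ofFn fun i => w (σ i)) := by
  induction p generalizing f with
  | zero =>
    rw [Subsingleton.elim σ 1, koszulSign_one, one_smul]
    rfl
  | succ p ih =>
    obtain ⟨⟨j, σ⟩, rfl⟩ := (insPerm_bijective p).2 σ
    simp only
    rw [koszulSign_insPerm, ofFn_insPerm, mul_comm, mul_smul, ← hf.ev_insertIdx _ _ _ (by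
      simp; omega), ev_cons, ← ih (hf.der _) (fun i => w i.succ), List.ofFn_succ, ev_cons]

theorem listDeg_ofFn {X : ℤ → Type*} {p : ℕ} (w : Fin p → Sigma X) :
    listDeg (List.ofFn w) = ∑ i, (w i).1 := by
  rw [listDeg, List.map_ofFn, List.sum_ofFn]; rfl

/-- In the list form both conditions pass to `der`, as the inductions require. -/
theorem mem_symHom_iff {𝒲 : ℤ → Submodule K W} {n : ℤ} {f : MultiSeq K V W} :
    f ∈ symHom 𝒱 𝒲 n ↔ IsGSymm 𝒱 f ∧ HasDeg 𝒱 𝒲 n f := by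
  constructor
  · intro hf
    constructor
    · intro P L v x
      obtain ⟨p, w, hw⟩ : ∃ (p : ℕ) (w : Fin p → Homog 𝒱), List.ofFn w = P ++ v :: x :: L :=
        ⟨_, (P ++ v :: x :: L).get, List.ofFn_get _⟩
      obtain ⟨σ, h1, h2⟩ := exists_koszulSign_eq_negOnePow P L v x w hw
      rw [← hw, ← h1, ← h2, ev_ofFn, ev_ofFn]
      exact (hf p (fun i => (w i).1) (fun i => (w i).2) fun i => (w i).2.2).2 σ
    · intro L
      obtain ⟨p, w, rfl⟩ : ∃ (p : ℕ) (w : Fin p → Homog 𝒱), L = List.ofFn w :=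
        ⟨L.length, L.get, (List.ofFn_get L).symm⟩
      rw [ev_ofFn, listDeg_ofFn]
      exact (hf p (fun i => (w i).1) (fun i => (w i).2) fun i => (w i).2.2).1
  · rintro ⟨h1, h2⟩ k d v hv
    let w : Fin k → Homog 𝒱 := fun i => ⟨d i, v i, hv i⟩
    refine ⟨?_, fun σ => ?_⟩
    · have := h2 (List.ofFn w)
      rwa [ev_ofFn, listDeg_ofFn] at this
    · have := h1.apply_perm w σ
      rwa [ev_ofFn, ev_ofFn] at this

theorem units_smul_mem {M : Type*} [AddCommGroup M] [Module K M] (S : Submodule K M) (a : ℤˣ)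
    {x : M} (hx : x ∈ S) : a • x ∈ S := by
  rw [units_smul_eq_smul (K := K)]; exact S.smul_mem _ hx

theorem splitSum_mem {X : ℤ → Type*} {M : Type*} [AddCommGroup M] [Module K M]
    (S : Submodule K M) {Φ : List (Sigma X) → List (Sigma X) → M} {L : List (Sigma X)}
    (h : ∀ A B, listDeg A + listDeg B = listDeg L → Φ A B ∈ S) : splitSum Φ L ∈ S := by
  induction L generalizing Φ with
  | nil => exact h _ _ rfl
  | cons v L ih =>
    refine S.add_mem (ih fun A B hAB => h _ _ (by simp [add_assoc, hAB]))
      (ih fun A B hAB => units_smul_mem S _ (h _ _ (by simp [← hAB]; ring)))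

theorem ev_prSeq_of_two_le {L : List (Homog 𝒱)} (h : 2 ≤ L.length) :
    ev (prSeq : MultiSeq K V V) L = 0 := by
  match L, h with
  | _ :: _ :: _, _ => rfl

theorem isGSymm_prSeq : IsGSymm 𝒱 (prSeq : MultiSeq K V V) := by
  intro P L v w
  rw [ev_prSeq_of_two_le (by simp; omega), ev_prSeq_of_two_le (by simp; omega), smul_zero]

theorem hasDeg_prSeq : HasDeg 𝒱 𝒱 0 (prSeq : MultiSeq K V V) := by
  intro L
  match L with
  | [] => simp
  | [x] => simp
  | _ :: _ :: _ => simp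

theorem HasDeg.mapSeq {𝒲 : ℤ → Submodule K W} {𝒲' : ℤ → Submodule K W₁} {n c : ℤ}
    {φ : W →ₗ[K] W₁} (hφ : ∀ a, ∀ x ∈ 𝒲 a, φ x ∈ 𝒲' (a + c)) {f : MultiSeq K V W}
    (hf : HasDeg 𝒱 𝒲 n f) : HasDeg 𝒱 𝒲' (n + c) (mapSeq φ f) := fun L => by
  have := hφ _ _ (hf L)
  rwa [add_right_comm] at this

theorem IsGSymm.mapSeq (φ : W →ₗ[K] W₁) {f : MultiSeq K V W}
    (hf : IsGSymm 𝒱 f) : IsGSymm 𝒱 (mapSeq φ f) := fun P L v w => by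
  rw [ev_mapSeq, hf P L v w, Units.smul_def, map_zsmul]; rfl

variable [DirectSum.Decomposition 𝒱]

theorem IsGSymm.der_der {f : MultiSeq K V W} (hf : IsGSymm 𝒱 f) (v w : Homog 𝒱) :
    HomotopyOOperator.der w (HomotopyOOperator.der v f) =
      Int.negOnePow (v.1 * w.1) • HomotopyOOperator.der v (HomotopyOOperator.der w f) :=
  multiSeq_ext 𝒱 fun L => by
    rw [ev_units_smul, ← ev_cons, ← ev_cons, ← ev_cons, ← ev_cons]
    exact hf [] L v w

/-- The prefix is stripped by `der`. For two leading vectors the Leibniz rule gives four terms: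
those with both in one factor use its symmetry, and the two mixed ones are exchanged. -/
theorem IsGSymm.hcup (B : W₁ →ₗ[K] W₂ →ₗ[K] W₃) (n : ℤ) {f : MultiSeq K V W₁}
    {g : MultiSeq K V W₂} (hf : IsGSymm 𝒱 f) (hg : IsGSymm 𝒱 g) :
    IsGSymm 𝒱 (hcup 𝒱 B n f g) := by
  intro P L v w
  induction P generalizing f g n with
  | nil =>
    simp only [List.nil_append, ev_cons, der_hcup, der_add, der_units_smul, hf.der_der v w,
      hg.der_der v w, hcup_units_smul_left, hcup_units_smul_right, ev_add, ev_units_smul, smul_add,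
      smul_smul, add_mul, Int.negOnePow_add]
    rw [add_right_comm n w.1 v.1, mul_comm w.1 v.1]
    generalize Int.negOnePow (v.1 * w.1) = a
    generalize Int.negOnePow (n * w.1) = b
    generalize Int.negOnePow (n * v.1) = c
    rcases Int.units_eq_one_or a with rfl | rfl <;> rcases Int.units_eq_one_or b with rfl | rfl <;>
      rcases Int.units_eq_one_or c with rfl | rfl <;> simp <;> abel
  | cons u P ih =>
    simp only [List.cons_append, ev_cons u, der_hcup, ev_add, ev_units_smul]
    rw [ih n (hf.der u) hg, ih (n + u.1) hf (hg.der u), smul_add, smul_comm]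

theorem HasDeg.hcup {𝒲₁ : ℤ → Submodule K W₁} {𝒲₂ : ℤ → Submodule K W₂}
    {𝒲₃ : ℤ → Submodule K W₃} {B : W₁ →ₗ[K] W₂ →ₗ[K] W₃} {c : ℤ}
    (hB : ∀ a b, ∀ x ∈ 𝒲₁ a, ∀ y ∈ 𝒲₂ b, B x y ∈ 𝒲₃ (a + b + c)) (k : ℤ) {m n : ℤ}
    {f : MultiSeq K V W₁} {g : MultiSeq K V W₂} (hf : HasDeg 𝒱 𝒲₁ m f) (hg : HasDeg 𝒱 𝒲₂ n g) :
    HasDeg 𝒱 𝒲₃ (m + n + c) (hcup 𝒱 B k f g) := by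
  intro L
  rw [ev_hcup]
  refine splitSum_mem _ fun A A' h => units_smul_mem _ _ ?_
  have := hB _ _ _ (hf A) _ (hg A')
  rw [← h]
  convert this using 2
  ring

/-- If `w` is not fed to `h`, it passes `A` in the splitting and is then moved by symmetry of `f` in
front of the value on `A`, of degree `e + listDeg A`. The degree of `A` enters twice and cancels. -/
theorem der_star {f : MultiSeq K V W} {h : MultiSeq K V V} {e : ℤ} (hf : IsGSymm 𝒱 f)
    (hh : HasDeg 𝒱 𝒱 e h) (w : Homog 𝒱) :
    der w (star 𝒱 f h) =
      star 𝒱 f (der w h) + Int.negOnePow (e * w.1) • star 𝒱 (der w f) h := by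
  refine multiSeq_ext 𝒱 fun L => ?_
  rw [← ev_cons, ev_star, splitSum, ev_add, ev_units_smul, ev_star, ev_star,
    ← splitSum_units_smul]
  congr 1
  · refine splitSum_congr fun A B _ => ?_
    rw [ev_cons]
  · refine splitSum_congr fun A B _ => ?_
    have h1 := hf [] B ⟨_, _, hh A⟩ w
    rw [List.nil_append, List.nil_append] at h1
    rw [ev_curry_of_mem _ (hh A), ev_curry_of_mem _ (hh A), h1, ev_cons w, smul_smul,
      ← Int.negOnePow_add]
    congr 1
    rw [Int.negOnePow_eq_iff]
    exact ⟨w.1 * listDeg A, by ring⟩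

@[simp] theorem ev_star_nil (f : MultiSeq K V W) (h : MultiSeq K V V) :
    ev (star 𝒱 f h) ([] : List (Homog 𝒱)) = ev (curry f) ([] : List (Homog 𝒱))
      (ev h ([] : List (Homog 𝒱))) := by
  rw [ev_star]; rfl

theorem star_add_left (f f' : MultiSeq K V W) (h : MultiSeq K V V) :
    star 𝒱 (f + f') h = star 𝒱 f h + star 𝒱 f' h :=
  hcup_add_right _ _ _ (curry f) (curry f')

theorem star_units_smul_left (a : ℤˣ) (f : MultiSeq K V W) (h : MultiSeq K V V) :
    star 𝒱 (a • f) h = a • star 𝒱 f h :=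
  hcup_units_smul_right _ _ _ _ (curry f)

theorem star_smul_left (a : K) (f : MultiSeq K V W) (h : MultiSeq K V V) :
    star 𝒱 (a • f) h = a • star 𝒱 f h :=
  hcup_smul_right _ _ _ _ (curry f)

theorem star_add_right (f : MultiSeq K V W) (h h' : MultiSeq K V V) :
    star 𝒱 f (h + h') = star 𝒱 f h + star 𝒱 f h' :=
  hcup_add_left _ _ _ _ _

theorem star_units_smul_right (a : ℤˣ) (f : MultiSeq K V W) (h : MultiSeq K V V) :
    star 𝒱 f (a • h) = a • star 𝒱 f h :=
  hcup_units_smul_left _ _ _ _ _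

theorem star_smul_right (a : K) (f : MultiSeq K V W) (h : MultiSeq K V V) :
    star 𝒱 f (a • h) = a • star 𝒱 f h :=
  hcup_smul_left _ _ _ _ _

theorem mapSeq_star (φ : W →ₗ[K] W₁) (f : MultiSeq K V W) (h : MultiSeq K V V) :
    mapSeq φ (star 𝒱 f h) = star 𝒱 (mapSeq φ f) h :=
  multiSeq_ext 𝒱 fun L => by
    rw [ev_mapSeq, ev_star, ev_star, splitSum_map]
    rfl

theorem IsGSymm.star {f : MultiSeq K V W} {h : MultiSeq K V V} {e : ℤ} (hf : IsGSymm 𝒱 f)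
    (hs : IsGSymm 𝒱 h) (hh : HasDeg 𝒱 𝒱 e h) : IsGSymm 𝒱 (star 𝒱 f h) := by
  intro P L v w
  induction P generalizing f h e with
  | nil =>
    simp only [List.nil_append, ev_cons, der_star hf hh, der_add, der_units_smul,
      der_star hf (hh.der _), der_star (hf.der _) hh, hf.der_der v w,
      hs.der_der v w, star_units_smul_left, star_units_smul_right, ev_add, ev_units_smul, smul_add,
      smul_smul, add_mul, Int.negOnePow_add]
    rw [mul_comm w.1 v.1]
    generalize Int.negOnePow (v.1 * w.1) = a
    generalize Int.negOnePow (e * w.1) = b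
    generalize Int.negOnePow (e * v.1) = c
    rcases Int.units_eq_one_or a with rfl | rfl <;> rcases Int.units_eq_one_or b with rfl | rfl <;>
      rcases Int.units_eq_one_or c with rfl | rfl <;> simp <;> abel
  | cons u P ih =>
    simp only [List.cons_append, ev_cons u, der_star hf hh, ev_add, ev_units_smul]
    rw [ih (hf.der u) hs hh, ih hf (hs.der u) (hh.der u), smul_add, smul_comm]

theorem HasDeg.star {𝒲 : ℤ → Submodule K W} {n e : ℤ} {f : MultiSeq K V W} {h : MultiSeq K V V}
    (hf : HasDeg 𝒱 𝒲 n f) (hh : HasDeg 𝒱 𝒱 e h) : HasDeg 𝒱 𝒲 (n + e) (star 𝒱 f h) := by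
  intro L
  rw [ev_star]
  refine splitSum_mem _ fun A A' hA => ?_
  have := hf (⟨_, _, hh A⟩ :: A')
  rw [ev_curry_of_mem _ (hh A), ← hA]
  convert this using 2
  rw [listDeg_cons]; ring

theorem IsGSymm.corestr {G : MultiSeq K V (Module.End K V)} (hG : IsGSymm 𝒱 G) :
    IsGSymm 𝒱 (corestr 𝒱 G) := IsGSymm.hcup _ _ hG isGSymm_prSeq

theorem HasDeg.corestr {n : ℤ} {G : MultiSeq K V (Module.End K V)}
    (hG : HasDeg 𝒱 (glGrading 𝒱) n G) : HasDeg 𝒱 𝒱 n (corestr 𝒱 G) := by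
  have := HasDeg.hcup (𝒲₃ := 𝒱) (c := 0) (B := (LinearMap.id : Module.End K V →ₗ[K] V →ₗ[K] V))
    (fun a b x hx y hy => by simpa using hx b y hy) 0 hG (hasDeg_prSeq (𝒱 := 𝒱))
  rwa [add_zero, add_zero] at this

end Symmetry

/-! ### Identities between cup products and compositions with coderivations -/

section Identities

variable {K : Type*} [Field K] {V W W₁ W₂ W₃ W₄ W₅ : Type*} [AddCommGroup V] [Module K V]
  [AddCommGroup W] [Module K W] [AddCommGroup W₁] [Module K W₁] [AddCommGroup W₂] [Module K W₂]
  [AddCommGroup W₃] [Module K W₃] [AddCommGroup W₄] [Module K W₄] [AddCommGroup W₅] [Module K W₅]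
  {𝒱 : ℤ → Submodule K V} [DirectSum.Decomposition 𝒱]

/-- The commutator of two coderivations is a coderivation. -/
theorem star_star {f : MultiSeq K V W} {a b : MultiSeq K V V} {m n : ℤ} (hf : IsGSymm 𝒱 f)
    (ha : IsGSymm 𝒱 a) (hb : IsGSymm 𝒱 b) (hda : HasDeg 𝒱 𝒱 m a) (hdb : HasDeg 𝒱 𝒱 n b) :
    star 𝒱 (star 𝒱 f a) b + Int.negOnePow (m * n) • star 𝒱 f (star 𝒱 b a) =
      star 𝒱 f (star 𝒱 a b) + Int.negOnePow (m * n) • star 𝒱 (star 𝒱 f b) a := by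
  refine multiSeq_ext 𝒱 fun L => ?_
  induction L generalizing f a b m n with
  | nil =>
    simp only [ev_add, ev_units_smul, ev_star_nil]
    have h1 := ev_curry_of_mem (star 𝒱 f a) hdb.ev_nil_mem []
    have h2 := ev_curry_of_mem (star 𝒱 f b) hda.ev_nil_mem []
    have h3 := ev_curry_of_mem a hdb.ev_nil_mem []
    have h4 := ev_curry_of_mem b hda.ev_nil_mem []
    -- In arity `0` both coderivations insert a vector, and the terms where `f` receives both
    -- vectors cancel by its symmetry.
    rw [h1, h2, h3, h4, ev_cons, ev_cons, ev_cons, ev_cons, der_star hf hda, der_star hf hdb]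
    simp only [ev_add, ev_units_smul, ev_star_nil]
    have h5 := ev_curry_of_mem
      (der (⟨m, _, hda.ev_nil_mem⟩ : Homog 𝒱) f) hdb.ev_nil_mem []
    have h6 := ev_curry_of_mem
      (der (⟨n, _, hdb.ev_nil_mem⟩ : Homog 𝒱) f) hda.ev_nil_mem []
    rw [h5, h6, ev_cons, ev_cons, hf.der_der, ev_units_smul]
    simp only [smul_add, smul_smul, mul_comm n m]
    generalize Int.negOnePow (m * n) = s
    rcases Int.units_eq_one_or s with rfl | rfl <;> simp <;> abel
  | cons w L ih =>
    -- By `der_star` the identity for `w :: L` is a signed sum of its instances with `w` absorbed by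
    -- `b`, by `a` or by `f`.
    have I1 := ih hf ha (hb.der w) hda (hdb.der w)
    have I2 := congrArg (Int.negOnePow (n * w.1) • ·) (ih hf (ha.der w) hb (hda.der w) hdb)
    have I3 := congrArg (Int.negOnePow ((m + n) * w.1) • ·) (ih (hf.der w) ha hb hda hdb)
    rw [ev_cons, ev_cons]
    simp only [der_add, der_units_smul, der_star (hf.star ha hda) hdb,
      der_star (hf.star hb hdb) hda, der_star hf (hda.star hdb), der_star hf (hdb.star hda),
      der_star hf hda, der_star hf hdb, der_star ha hdb, der_star hb hda,
      star_add_left, star_add_right, star_units_smul_left, star_units_smul_right, ev_add,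
      ev_units_smul, smul_add, smul_smul, add_mul, mul_add, Int.negOnePow_add] at I1 I2 I3 ⊢
    rw [mul_comm w.1 n] at I2
    generalize Int.negOnePow (m * n) = s at *
    generalize Int.negOnePow (m * w.1) = t at *
    generalize Int.negOnePow (n * w.1) = u at *
    rcases Int.units_eq_one_or s with rfl | rfl <;> rcases Int.units_eq_one_or t with rfl | rfl <;>
      rcases Int.units_eq_one_or u with rfl | rfl <;> simp at I1 I2 I3 ⊢ <;>
      linear_combination (norm := module) I1 + I2 + I3

/-- Coderivations are derivations of cup products. -/
theorem star_hcup (B : W₁ →ₗ[K] W₂ →ₗ[K] W₃) (n : ℤ) {f : MultiSeq K V W₁} {g : MultiSeq K V W₂}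
    {a : MultiSeq K V V} {m : ℤ} (hf : IsGSymm 𝒱 f) (hg : IsGSymm 𝒱 g) (ha : HasDeg 𝒱 𝒱 m a) :
    star 𝒱 (hcup 𝒱 B n f g) a =
      Int.negOnePow (n * m) • hcup 𝒱 B n (star 𝒱 f a) g + hcup 𝒱 B (n + m) f (star 𝒱 g a) := by
  refine multiSeq_ext 𝒱 fun L => ?_
  induction L generalizing f g a n m with
  | nil =>
    simp only [ev_add, ev_units_smul, ev_star_nil, ev_hcup_nil]
    have h1 := ev_curry_of_mem (hcup 𝒱 B n f g) ha.ev_nil_mem []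
    have h2 := ev_curry_of_mem f ha.ev_nil_mem []
    have h3 := ev_curry_of_mem g ha.ev_nil_mem []
    rw [h1, h2, h3, ev_cons, ev_cons, ev_cons, der_hcup]
    simp only [ev_add, ev_units_smul, ev_hcup_nil]
  | cons w L ih =>
    have I1 := ih n hf hg (ha.der w)
    have I2 := congrArg (Int.negOnePow (m * w.1) • Int.negOnePow (n * w.1) • ·)
      (ih n (hf.der w) hg ha)
    have I3 := congrArg (Int.negOnePow (m * w.1) • ·) (ih (n + w.1) hf (hg.der w) ha)
    rw [ev_cons, ev_cons]
    simp only [der_add, der_units_smul, der_star (hf.hcup B n hg) ha, der_star hf ha,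
      der_star hg ha, der_hcup, star_add_left, hcup_add_left, hcup_add_right,
      hcup_units_smul_left, hcup_units_smul_right, star_units_smul_left, ev_add,
      ev_units_smul, smul_add, smul_smul, add_mul, mul_add, Int.negOnePow_add, ← add_assoc]
      at I1 I2 I3 ⊢
    rw [mul_comm w.1 m, add_right_comm n w.1 m] at I3
    rw [I1, I2, I3]
    generalize Int.negOnePow (n * m) = s at *
    generalize Int.negOnePow (m * w.1) = t at *
    generalize Int.negOnePow (n * w.1) = u at *
    rcases Int.units_eq_one_or s with rfl | rfl <;> rcases Int.units_eq_one_or t with rfl | rfl <;>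
      rcases Int.units_eq_one_or u with rfl | rfl <;> simp <;> abel

/-- Four bilinear maps are allowed so that this covers both composition in `gl(V)` and the action of
`gl(V)` on `V`. -/
theorem hcup_assoc {B₁ : W₃ →ₗ[K] W₄ →ₗ[K] W} {B₂ : W₁ →ₗ[K] W₂ →ₗ[K] W₃}
    {B₃ : W₁ →ₗ[K] W₅ →ₗ[K] W} {B₄ : W₂ →ₗ[K] W₄ →ₗ[K] W₅}
    (hB : ∀ x y z, B₁ (B₂ x y) z = B₃ x (B₄ y z)) (n p : ℤ) (f : MultiSeq K V W₁)
    (g : MultiSeq K V W₂) (h : MultiSeq K V W₄) :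
    hcup 𝒱 B₁ p (hcup 𝒱 B₂ n f g) h = hcup 𝒱 B₃ (n + p) f (hcup 𝒱 B₄ p g h) := by
  refine multiSeq_ext 𝒱 fun L => ?_
  induction L generalizing f g h n p with
  | nil => simp [hB]
  | cons w L ih =>
    rw [ev_cons, ev_cons]
    simp only [der_hcup, hcup_add_left, hcup_add_right,
      hcup_units_smul_left, hcup_units_smul_right, ev_add, ev_units_smul, smul_add, smul_smul,
      add_mul, Int.negOnePow_add, ih, ← add_assoc]
    rw [add_right_comm n w.1 p, mul_comm (Int.negOnePow (p * w.1))]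

theorem hcup_symm {𝒢 : ℤ → Submodule K W} {B : W →ₗ[K] W →ₗ[K] W}
    (hB : ∀ a b, ∀ x ∈ 𝒢 a, ∀ y ∈ 𝒢 b, B x y = Int.negOnePow (a * b) • B y x) {m n : ℤ}
    {f g : MultiSeq K V W} (hf : HasDeg 𝒱 𝒢 m f) (hg : HasDeg 𝒱 𝒢 n g) :
    hcup 𝒱 B n f g = Int.negOnePow (m * n) • hcup 𝒱 B m g f := by
  refine multiSeq_ext 𝒱 fun L => ?_
  induction L generalizing f g m n with
  | nil => simpa using hB m n _ hf.ev_nil_mem _ hg.ev_nil_mem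
  | cons w L ih =>
    rw [ev_cons, ev_cons]
    simp only [der_units_smul, der_hcup, ev_add, ev_units_smul, smul_add, smul_smul]
    have I1 := ih (hf.der w) hg
    have I2 := ih hf (hg.der w)
    rw [I1, I2, add_comm]
    simp only [ev_units_smul, smul_smul, add_mul, mul_add, Int.negOnePow_add]
    rw [mul_comm w.1 n]
    generalize Int.negOnePow (m * n) = s at *
    generalize Int.negOnePow (m * w.1) = t at *
    generalize Int.negOnePow (n * w.1) = u at *
    rcases Int.units_eq_one_or s with rfl | rfl <;> rcases Int.units_eq_one_or t with rfl | rfl <;>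
      rcases Int.units_eq_one_or u with rfl | rfl <;> simp

theorem units_mul_self_mul (x y : ℤˣ) : x * (x * y) = y := by
  rw [← mul_assoc, Int.units_mul_self, one_mul]

/-- Arity `0` is the Leibniz axiom. The sign parameter is always the degree of the right factor; the
bracket has degree `1`, whence `n + p + 1` and `m + p + 1`. -/
theorem hcup_leibniz {𝒢 : ℤ → Submodule K W} {B : W →ₗ[K] W →ₗ[K] W}
    (hB : IsSymmGradedLieAlgebra 𝒢 B) {m n p : ℤ} {f g h : MultiSeq K V W}
    (hf : HasDeg 𝒱 𝒢 m f) (hg : HasDeg 𝒱 𝒢 n g) (hh : HasDeg 𝒱 𝒢 p h) :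
    hcup 𝒱 B (n + p + 1) f (hcup 𝒱 B p g h) =
      Int.negOnePow (m + 1) • hcup 𝒱 B p (hcup 𝒱 B n f g) h +
      Int.negOnePow ((m + 1) * (n + 1)) • hcup 𝒱 B (m + p + 1) g (hcup 𝒱 B p f h) := by
  refine multiSeq_ext 𝒱 fun L => ?_
  induction L generalizing f g h m n p with
  | nil =>
    simpa using hB.leibniz m n p _ hf.ev_nil_mem _ hg.ev_nil_mem _ hh.ev_nil_mem
  | cons w L ih =>
    rw [ev_cons, ev_cons]
    have I1 := ih (hf.der w) hg hh
    have I2 := ih hf (hg.der w) hh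
    have I3 := ih hf hg (hh.der w)
    rw [show n + w.1 + p + 1 = n + p + 1 + w.1 by ring] at I2
    rw [show n + (p + w.1) + 1 = n + p + 1 + w.1 by ring,
      show m + (p + w.1) + 1 = m + p + 1 + w.1 by ring] at I3
    rw [show m + w.1 + p + 1 = m + p + 1 + w.1 by ring] at I1
    simp only [der_add, der_units_smul, der_hcup, hcup_add_left, hcup_add_right,
      hcup_units_smul_left, hcup_units_smul_right, ev_add, ev_units_smul, smul_add, smul_smul,
      add_mul, mul_add, one_mul, mul_one, Int.negOnePow_add, Int.negOnePow_one] at I1 I2 I3 ⊢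
    rw [I1, I2, I3, mul_comm w.1 n]
    simp only [mul_neg, Units.neg_smul, smul_neg, mul_one, mul_comm,
      mul_left_comm, mul_assoc, smul_add, smul_smul, units_mul_self_mul]
    abel

/-- Arity `0` is the compatibility of `ρ` with brackets; the parameters become `n + 1` and `m + 1`
since `ρ` has degree `1`. -/
theorem mapSeq_hcup_of_rep {𝒢 : ℤ → Submodule K W} {B : W →ₗ[K] W →ₗ[K] W}
    {ρ : W →ₗ[K] Module.End K V} (hρ : IsSymmGradedLieRep 𝒱 𝒢 B ρ) {m n : ℤ}
    {f g : MultiSeq K V W} (hf : HasDeg 𝒱 𝒢 m f) (hg : HasDeg 𝒱 𝒢 n g) :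
    mapSeq ρ (hcup 𝒱 B n f g) = Int.negOnePow (m + 1) •
      (hcup 𝒱 (LinearMap.mul K (Module.End K V)) (n + 1) (mapSeq ρ f) (mapSeq ρ g) -
        Int.negOnePow ((m + 1) * (n + 1)) •
          hcup 𝒱 (LinearMap.mul K (Module.End K V)) (m + 1) (mapSeq ρ g) (mapSeq ρ f)) := by
  refine multiSeq_ext 𝒱 fun L => ?_
  induction L generalizing f g m n with
  | nil =>
    have := hρ.map_bracket m n _ hf.ev_nil_mem _ hg.ev_nil_mem
    simpa [desuspGlBracket, glCommutator] using this
  | cons w L ih =>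
    have I1 := ih (hf.der w) hg
    have I2 := ih hf (hg.der w)
    rw [show m + w.1 + 1 = m + 1 + w.1 by ring] at I1
    rw [show n + w.1 + 1 = n + 1 + w.1 by ring] at I2
    rw [ev_cons, ev_cons, der_mapSeq, der_hcup]
    have e : ∀ (a : ℤˣ) (X Y : MultiSeq K V W), ev (mapSeq ρ (a • X + Y)) L =
        a • ev (mapSeq ρ X) L + ev (mapSeq ρ Y) L := fun a X Y => by
      rw [ev_mapSeq, ev_add, map_add, ev_units_smul, Units.smul_def, map_zsmul]
      rfl
    have e' : ∀ X Y : MultiSeq K V (Module.End K V), der w (X - Y) = der w X - der w Y :=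
      fun X Y => rfl
    rw [e, I1, I2]
    simp only [e', der_units_smul, der_hcup, der_mapSeq, ev_sub, ev_add, ev_units_smul, smul_add,
      smul_sub, smul_smul, add_mul, mul_add, one_mul, mul_one, Int.negOnePow_add,
      Int.negOnePow_one]
    rw [mul_comm w.1 n]
    simp only [mul_neg, Units.neg_smul, neg_neg, mul_one, mul_comm,
      mul_left_comm, mul_assoc, Int.units_mul_self, units_mul_self_mul]
    abel

end Identities

/-! ### Additivity and homogeneity of the operations -/

section Linearity

variable {K : Type*} [Field K] {V W W₁ W₂ W₃ : Type*} [AddCommGroup V] [Module K V]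
  [AddCommGroup W] [Module K W] [AddCommGroup W₁] [Module K W₁] [AddCommGroup W₂] [Module K W₂]
  [AddCommGroup W₃] [Module K W₃] {𝒱 : ℤ → Submodule K V} [DirectSum.Decomposition 𝒱]

theorem hcup_sub_left (B : W₁ →ₗ[K] W₂ →ₗ[K] W₃) (n : ℤ) (f f' : MultiSeq K V W₁)
    (g : MultiSeq K V W₂) : hcup 𝒱 B n (f - f') g = hcup 𝒱 B n f g - hcup 𝒱 B n f' g :=
  eq_sub_of_add_eq (by rw [← hcup_add_left, sub_add_cancel])

theorem hcup_sub_right (B : W₁ →ₗ[K] W₂ →ₗ[K] W₃) (n : ℤ) (f : MultiSeq K V W₁)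
    (g g' : MultiSeq K V W₂) : hcup 𝒱 B n f (g - g') = hcup 𝒱 B n f g - hcup 𝒱 B n f g' :=
  eq_sub_of_add_eq (by rw [← hcup_add_right, sub_add_cancel])

theorem star_sub_left (f f' : MultiSeq K V W) (h : MultiSeq K V V) :
    star 𝒱 (f - f') h = star 𝒱 f h - star 𝒱 f' h :=
  eq_sub_of_add_eq (by rw [← star_add_left, sub_add_cancel])

theorem star_sub_right (f : MultiSeq K V W) (h h' : MultiSeq K V V) :
    star 𝒱 f (h - h') = star 𝒱 f h - star 𝒱 f h' :=
  eq_sub_of_add_eq (by rw [← star_add_right, sub_add_cancel])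

theorem corestr_add (G G' : MultiSeq K V (Module.End K V)) :
    corestr 𝒱 (G + G') = corestr 𝒱 G + corestr 𝒱 G' := hcup_add_left _ _ _ _ _

theorem corestr_sub (G G' : MultiSeq K V (Module.End K V)) :
    corestr 𝒱 (G - G') = corestr 𝒱 G - corestr 𝒱 G' := hcup_sub_left _ _ _ _ _

theorem corestr_smul (a : K) (G : MultiSeq K V (Module.End K V)) :
    corestr 𝒱 (a • G) = a • corestr 𝒱 G := hcup_smul_left _ _ _ _ _

theorem corestr_units_smul (a : ℤˣ) (G : MultiSeq K V (Module.End K V)) :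
    corestr 𝒱 (a • G) = a • corestr 𝒱 G := hcup_units_smul_left _ _ _ _ _

theorem map_units_smul' {F M N : Type*} [AddCommGroup M] [AddCommGroup N] [FunLike F M N]
    [AddMonoidHomClass F M N] (φ : F) (a : ℤˣ) (x : M) : φ (a • x) = a • φ x := by
  rw [Units.smul_def, map_zsmul, ← Units.smul_def]

end Linearity

/-! ### The pre-Lie product on `C̄*(V, V)` -/

section Diamond

variable {K : Type*} [Field K] {V W : Type*} [AddCommGroup V] [Module K V]
  [AddCommGroup W] [Module K W] {𝒱 : ℤ → Submodule K V} [DirectSum.Decomposition 𝒱]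

theorem diamond_eq (n : ℤ) (F G : MultiSeq K V (Module.End K V)) :
    diamond 𝒱 n F G = star 𝒱 F (corestr 𝒱 G) +
      hcup 𝒱 (LinearMap.mul K (Module.End K V)) n F G := by
  rw [diamond, insertion_eq_star, cup_eq_hcup]

/-- A coderivation followed by the projection to `V` is its corestriction: only the splitting with
empty second block contributes. -/
theorem star_prSeq (a : MultiSeq K V V) : star 𝒱 prSeq a = a :=
  multiSeq_ext 𝒱 fun L => by
    rw [ev_star]
    have h : ∀ (B : List (Homog 𝒱)) (x : V),
        ev (curry prSeq) B x = if B = [] then x else 0 := by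
      intro B x
      cases B <;> rfl
    simp only [h]
    generalize ev a = Ψ
    induction L generalizing Ψ with
    | nil => simp [splitSum]
    | cons v L ih =>
      simp only [splitSum, List.cons_ne_nil, if_false, smul_zero]
      rw [ih fun A => Ψ (v :: A), splitSum_zero, add_zero]

theorem star_mem {𝒲 : ℤ → Submodule K W} {m n : ℤ} {f : MultiSeq K V W} {a : MultiSeq K V V}
    (hf : f ∈ symHom 𝒱 𝒲 m) (ha : a ∈ symHom 𝒱 𝒱 n) : star 𝒱 f a ∈ symHom 𝒱 𝒲 (m + n) := by
  rw [mem_symHom_iff] at *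
  exact ⟨hf.1.star ha.1 ha.2, hf.2.star ha.2⟩

theorem corestr_mem {n : ℤ} {G : MultiSeq K V (Module.End K V)} (hG : G ∈ barC 𝒱 n) :
    corestr 𝒱 G ∈ symHom 𝒱 𝒱 n := by
  rw [barC, mem_symHom_iff] at *
  exact ⟨hG.1.corestr, hG.2.corestr⟩

theorem hcup_mem {W₁ W₂ W₃ : Type*} [AddCommGroup W₁] [Module K W₁] [AddCommGroup W₂]
    [Module K W₂] [AddCommGroup W₃] [Module K W₃] {𝒲₁ : ℤ → Submodule K W₁}
    {𝒲₂ : ℤ → Submodule K W₂} {𝒲₃ : ℤ → Submodule K W₃} {B : W₁ →ₗ[K] W₂ →ₗ[K] W₃} {c : ℤ}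
    (hB : ∀ a b, ∀ x ∈ 𝒲₁ a, ∀ y ∈ 𝒲₂ b, B x y ∈ 𝒲₃ (a + b + c)) (k : ℤ) {m n : ℤ}
    {f : MultiSeq K V W₁} {g : MultiSeq K V W₂} (hf : f ∈ symHom 𝒱 𝒲₁ m)
    (hg : g ∈ symHom 𝒱 𝒲₂ n) : hcup 𝒱 B k f g ∈ symHom 𝒱 𝒲₃ (m + n + c) := by
  rw [mem_symHom_iff] at *
  exact ⟨hf.1.hcup B k hg.1, HasDeg.hcup hB k hf.2 hg.2⟩

omit [DirectSum.Decomposition 𝒱] in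
theorem mul_mem_glGrading (a b : ℤ) (x : Module.End K V) (hx : x ∈ glGrading 𝒱 a)
    (y : Module.End K V) (hy : y ∈ glGrading 𝒱 b) :
    LinearMap.mul K (Module.End K V) x y ∈ glGrading 𝒱 (a + b + 0) := fun i v hv => by
  have := hx _ _ (hy i v hv)
  rwa [← add_assoc, ← add_zero (a + b)] at this

theorem diamond_mem {m n : ℤ} {F G : MultiSeq K V (Module.End K V)} (hF : F ∈ barC 𝒱 m)
    (hG : G ∈ barC 𝒱 n) (k : ℤ) : diamond 𝒱 k F G ∈ barC 𝒱 (m + n) := by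
  rw [diamond_eq]
  refine add_mem (star_mem hF (corestr_mem hG)) ?_
  have := hcup_mem mul_mem_glGrading k hF hG
  rwa [add_zero] at this

/-- This is where `⋄` comes from: `D_H` acts as a derivation on the cup product of `G` with the
projection. Acting on `G` gives the insertion term; acting on the projection gives, by
associativity, the composition term. -/
theorem star_corestr_corestr {n : ℤ} {G H : MultiSeq K V (Module.End K V)}
    (hG : IsGSymm 𝒱 G) (hH : H ∈ barC 𝒱 n) :
    star 𝒱 (corestr 𝒱 G) (corestr 𝒱 H) = corestr 𝒱 (diamond 𝒱 n G H) := by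
  have hH' := mem_symHom_iff.1 (corestr_mem hH)
  have h1 := hcup_assoc (𝒱 := 𝒱) (B₁ := (LinearMap.id : Module.End K V →ₗ[K] V →ₗ[K] V))
    (B₂ := LinearMap.mul K (Module.End K V))
    (B₃ := (LinearMap.id : Module.End K V →ₗ[K] V →ₗ[K] V))
    (B₄ := (LinearMap.id : Module.End K V →ₗ[K] V →ₗ[K] V))
    (fun x y z => rfl) n 0 G H prSeq
  have h2 := star_hcup (LinearMap.id : Module.End K V →ₗ[K] V →ₗ[K] V) 0 hG isGSymm_prSeq hH'.2
  rw [star_prSeq, zero_mul, Int.negOnePow_zero, one_smul, zero_add] at h2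
  rw [add_zero] at h1
  rw [diamond_eq, corestr_add]
  exact h2.trans (congrArg _ h1.symm)

/-- `f ↦ f ∘ D_G` is a right action of the graded Lie algebra `C̄*(V, V)`. -/
theorem star_star_corestr {n p : ℤ} {f : MultiSeq K V W} {G H : MultiSeq K V (Module.End K V)}
    (hf : IsGSymm 𝒱 f) (hG : G ∈ barC 𝒱 n) (hH : H ∈ barC 𝒱 p) :
    star 𝒱 (star 𝒱 f (corestr 𝒱 G)) (corestr 𝒱 H) +
        Int.negOnePow (n * p) • star 𝒱 f (corestr 𝒱 (diamond 𝒱 n H G)) =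
      star 𝒱 f (corestr 𝒱 (diamond 𝒱 p G H)) +
        Int.negOnePow (n * p) • star 𝒱 (star 𝒱 f (corestr 𝒱 H)) (corestr 𝒱 G) := by
  have hG' := mem_symHom_iff.1 (corestr_mem hG)
  have hH' := mem_symHom_iff.1 (corestr_mem hH)
  rw [← star_corestr_corestr (mem_symHom_iff.1 hG).1 hH,
    ← star_corestr_corestr (mem_symHom_iff.1 hH).1 hG]
  exact star_star hf hG'.1 hH'.1 hG'.2 hH'.2

/-- The graded right pre-Lie identity for `⋄`. -/
theorem diamond_diamond {n p : ℤ} {F G H : MultiSeq K V (Module.End K V)}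
    (hF : IsGSymm 𝒱 F) (hG : G ∈ barC 𝒱 n) (hH : H ∈ barC 𝒱 p) :
    diamond 𝒱 p (diamond 𝒱 n F G) H +
        Int.negOnePow (n * p) • diamond 𝒱 (n + p) F (diamond 𝒱 n H G) =
      diamond 𝒱 (n + p) F (diamond 𝒱 p G H) +
        Int.negOnePow (n * p) • diamond 𝒱 n (diamond 𝒱 p F H) G := by
  have hG' := mem_symHom_iff.1 (corestr_mem hG)
  have hH' := mem_symHom_iff.1 (corestr_mem hH)
  -- `key` accounts for the terms `F ∘ D`; all terms with a cup product cancel by the derivation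
  -- rule and associativity.
  have key := star_star_corestr hF hG hH
  simp only [diamond_eq, star_add_left, star_add_right, hcup_add_left, hcup_add_right, corestr_add,
    star_hcup _ n hF (mem_symHom_iff.1 hG).1 hH'.2, star_hcup _ p hF (mem_symHom_iff.1 hH).1 hG'.2,
    hcup_assoc (B₁ := LinearMap.mul K (Module.End K V)) (B₂ := LinearMap.mul K (Module.End K V))
      (B₃ := LinearMap.mul K (Module.End K V)) (B₄ := LinearMap.mul K (Module.End K V))
      mul_assoc, smul_add, smul_smul, add_comm p n, mul_comm p n, Int.units_mul_self, one_smul]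
    at key ⊢
  rw [← sub_eq_zero] at key ⊢
  rw [← key]
  abel

theorem diamond_sub_left (n : ℤ) (F F' G : MultiSeq K V (Module.End K V)) :
    diamond 𝒱 n (F - F') G = diamond 𝒱 n F G - diamond 𝒱 n F' G := by
  simp only [diamond_eq, star_sub_left, hcup_sub_left]; abel

theorem diamond_sub_right (n : ℤ) (F G G' : MultiSeq K V (Module.End K V)) :
    diamond 𝒱 n F (G - G') = diamond 𝒱 n F G - diamond 𝒱 n F G' := by
  simp only [diamond_eq, corestr_sub, star_sub_right, hcup_sub_right]; abel

theorem diamond_add_left (n : ℤ) (F F' G : MultiSeq K V (Module.End K V)) :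
    diamond 𝒱 n (F + F') G = diamond 𝒱 n F G + diamond 𝒱 n F' G := by
  simp only [diamond_eq, star_add_left, hcup_add_left]; abel

theorem diamond_add_right (n : ℤ) (F G G' : MultiSeq K V (Module.End K V)) :
    diamond 𝒱 n F (G + G') = diamond 𝒱 n F G + diamond 𝒱 n F G' := by
  simp only [diamond_eq, corestr_add, star_add_right, hcup_add_right]; abel

theorem diamond_smul_left (n : ℤ) (a : K) (F G : MultiSeq K V (Module.End K V)) :
    diamond 𝒱 n (a • F) G = a • diamond 𝒱 n F G := by
  simp only [diamond_eq, star_smul_left, hcup_smul_left, smul_add]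

theorem diamond_smul_right (n : ℤ) (a : K) (F G : MultiSeq K V (Module.End K V)) :
    diamond 𝒱 n F (a • G) = a • diamond 𝒱 n F G := by
  simp only [diamond_eq, corestr_smul, star_smul_right, hcup_smul_right, smul_add]

theorem diamond_units_smul_left (n : ℤ) (a : ℤˣ) (F G : MultiSeq K V (Module.End K V)) :
    diamond 𝒱 n (a • F) G = a • diamond 𝒱 n F G := by
  rw [units_smul_eq_smul (K := K), diamond_smul_left, ← units_smul_eq_smul]

theorem diamond_units_smul_right (n : ℤ) (a : ℤˣ) (F G : MultiSeq K V (Module.End K V)) :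
    diamond 𝒱 n F (a • G) = a • diamond 𝒱 n F G := by
  rw [units_smul_eq_smul (K := K), diamond_smul_right, ← units_smul_eq_smul]

theorem clBracket_mem {m n : ℤ} {F G : MultiSeq K V (Module.End K V)} (hF : F ∈ barC 𝒱 m)
    (hG : G ∈ barC 𝒱 n) : clBracket 𝒱 m n F G ∈ barC 𝒱 (m + n) :=
  sub_mem (units_smul_mem _ _ (add_comm n m ▸ diamond_mem hG hF m)) (diamond_mem hF hG n)

variable (𝒱) in
theorem isGradedLieAlgebra_clBracket : IsGradedLieAlgebra (barC 𝒱) (clBracket 𝒱) where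
  bracket_mem m n x hx y hy := clBracket_mem hx hy
  add_left m n x _ x' _ y _ := by
    simp only [clBracket, diamond_add_left, diamond_add_right, smul_add]; abel
  smul_left m n a x _ y _ := by
    simp only [clBracket, diamond_smul_left, diamond_smul_right, smul_sub]
    rw [smul_comm]
  add_right m n x _ y _ y' _ := by
    simp only [clBracket, diamond_add_left, diamond_add_right, smul_add]; abel
  smul_right m n a x _ y _ := by
    simp only [clBracket, diamond_smul_left, diamond_smul_right, smul_sub]
    rw [smul_comm]
  skew m n x _ y _ := by
    simp only [clBracket, smul_sub, smul_smul, mul_comm n m, Int.units_mul_self, one_smul]; abel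
  jacobi m n p x hx y hy z hz := by
    have R1 := diamond_diamond (mem_symHom_iff.1 hx).1 hy hz
    have R2 := diamond_diamond (mem_symHom_iff.1 hy).1 hx hz
    have R3 := diamond_diamond (mem_symHom_iff.1 hz).1 hx hy
    simp only [clBracket, diamond_sub_left, diamond_sub_right, diamond_units_smul_left,
      diamond_units_smul_right, smul_sub, smul_smul, mul_add, add_mul, Int.negOnePow_add]
      at R1 R2 R3 ⊢
    rw [mul_comm n m]
    generalize Int.negOnePow (m * n) = s at *
    generalize Int.negOnePow (m * p) = t at *
    generalize Int.negOnePow (n * p) = u at *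
    rcases Int.units_eq_one_or s with rfl | rfl <;> rcases Int.units_eq_one_or t with rfl | rfl <;>
      rcases Int.units_eq_one_or u with rfl | rfl <;> simp at R1 R2 R3 ⊢ <;>
      -- The Jacobi identity is a signed sum of the pre-Lie identities with `x`, `y`, `z` as
      -- leftmost factor; the signs of `R2` and `R3` depend on the parities.
      first
      | linear_combination (norm := module) -R1 + R2 - R3
      | linear_combination (norm := module) -R1 + R2 + R3
      | linear_combination (norm := module) -R1 - R2 - R3
      | linear_combination (norm := module) -R1 - R2 + R3

end Diamond

/-! ### The bracket on `sC*(V, 𝔤)` -/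

section OBracket

variable {K : Type*} [Field K] {V 𝔤 : Type*} [AddCommGroup V] [Module K V]
  [AddCommGroup 𝔤] [Module K 𝔤] {𝒱 : ℤ → Submodule K V} [DirectSum.Decomposition 𝒱]
  {𝒢 : ℤ → Submodule K 𝔤} {br : 𝔤 →ₗ[K] 𝔤 →ₗ[K] 𝔤} {ρ : 𝔤 →ₗ[K] Module.End K V}

theorem suspendedOBracket_eq (br : 𝔤 →ₗ[K] 𝔤 →ₗ[K] 𝔤) (ρ : 𝔤 →ₗ[K] Module.End K V) (m n : ℤ)
    (f g : MultiSeq K V 𝔤) :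
    suspendedOBracket 𝒱 br ρ m n f g =
      Int.negOnePow (m * n) • star 𝒱 g (corestr 𝒱 (psi ρ f)) - star 𝒱 f (corestr 𝒱 (psi ρ g)) -
        Int.negOnePow m • hcup 𝒱 br (n - 1) f g := by
  rw [suspendedOBracket, oBracket, insertion_eq_star, insertion_eq_star, cup_eq_hcup,
    sub_add_cancel, sub_add_cancel]
  abel

omit [DirectSum.Decomposition 𝒱] in
theorem psi_mem (hρ : IsSymmGradedLieRep 𝒱 𝒢 br ρ) {n : ℤ} {f : MultiSeq K V 𝔤}
    (hf : f ∈ suspendedC 𝒱 𝒢 n) : psi ρ f ∈ barC 𝒱 n := by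
  rw [suspendedC, mem_symHom_iff] at hf
  rw [barC, mem_symHom_iff]
  refine ⟨hf.1.mapSeq ρ, ?_⟩
  have := hf.2.mapSeq hρ.map_mem
  rwa [sub_add_cancel] at this

/-- Composition with `ρ` commutes with coderivations, which matches the insertion terms; the
representation property turns the cup term into the commutator of the composition terms of `⋄`. -/
theorem psi_suspendedOBracket (hρ : IsSymmGradedLieRep 𝒱 𝒢 br ρ) {m n : ℤ}
    {f g : MultiSeq K V 𝔤} (hf : f ∈ suspendedC 𝒱 𝒢 m) (hg : g ∈ suspendedC 𝒱 𝒢 n) :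
    psi ρ (suspendedOBracket 𝒱 br ρ m n f g) = clBracket 𝒱 m n (psi ρ f) (psi ρ g) := by
  rw [suspendedC, mem_symHom_iff] at hf hg
  have h1 : ∀ (f : MultiSeq K V 𝔤) (a : MultiSeq K V V),
      psi ρ (star 𝒱 f a) = star 𝒱 (psi ρ f) a := mapSeq_star ρ
  have h2 : psi ρ (hcup 𝒱 br (n - 1) f g) = _ := mapSeq_hcup_of_rep hρ hf.2 hg.2
  have h3 : ∀ f, mapSeq ρ f = psi (V := V) ρ f := fun _ => rfl
  rw [suspendedOBracket_eq, clBracket, diamond_eq, diamond_eq]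
  simp only [map_sub, map_units_smul', h1, h2, h3, sub_add_cancel, smul_add, smul_sub, smul_smul,
    Int.units_mul_self, units_mul_self_mul, one_smul]
  abel

theorem suspendedOBracket_mem (hbr : IsSymmGradedLieAlgebra 𝒢 br)
    (hρ : IsSymmGradedLieRep 𝒱 𝒢 br ρ) {m n : ℤ}
    {f g : MultiSeq K V 𝔤} (hf : f ∈ suspendedC 𝒱 𝒢 m) (hg : g ∈ suspendedC 𝒱 𝒢 n) :
    suspendedOBracket 𝒱 br ρ m n f g ∈ suspendedC 𝒱 𝒢 (m + n) := by
  rw [suspendedOBracket_eq]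
  have h1 := star_mem hg (corestr_mem (psi_mem hρ hf))
  have h2 := star_mem hf (corestr_mem (psi_mem hρ hg))
  have h3 := hcup_mem hbr.bracket_mem (n - 1) hf hg
  rw [show n - 1 + m = m + n - 1 by ring] at h1
  rw [show m - 1 + n = m + n - 1 by ring] at h2
  rw [show m - 1 + (n - 1) + 1 = m + n - 1 by ring] at h3
  exact sub_mem (sub_mem (units_smul_mem _ _ h1) h2) (units_smul_mem _ _ h3)

theorem suspendedOBracket_jacobi (hbr : IsSymmGradedLieAlgebra 𝒢 br)
    (hρ : IsSymmGradedLieRep 𝒱 𝒢 br ρ) {m n p : ℤ} {f g h : MultiSeq K V 𝔤}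
    (hf : f ∈ suspendedC 𝒱 𝒢 m) (hg : g ∈ suspendedC 𝒱 𝒢 n) (hh : h ∈ suspendedC 𝒱 𝒢 p) :
    suspendedOBracket 𝒱 br ρ m (n + p) f (suspendedOBracket 𝒱 br ρ n p g h) =
      suspendedOBracket 𝒱 br ρ (m + n) p (suspendedOBracket 𝒱 br ρ m n f g) h +
        Int.negOnePow (m * n) •
          suspendedOBracket 𝒱 br ρ n (m + p) g (suspendedOBracket 𝒱 br ρ m p f h) := by
  have hF := psi_mem hρ hf
  have hG := psi_mem hρ hg
  have hH := psi_mem hρ hh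
  have hF' := (mem_symHom_iff.1 (corestr_mem hF)).2
  have hG' := (mem_symHom_iff.1 (corestr_mem hG)).2
  have hH' := (mem_symHom_iff.1 (corestr_mem hH)).2
  have sf := (mem_symHom_iff.1 hf)
  have sg := (mem_symHom_iff.1 hg)
  have sh := (mem_symHom_iff.1 hh)
  have R1 := star_star_corestr sf.1 hG hH
  have R2 := star_star_corestr sg.1 hF hH
  have R3 := star_star_corestr sh.1 hF hG
  have R4 := hcup_leibniz hbr sf.2 sg.2 sh.2
  -- Of the cup terms with one coderivation, only that of `f ∘ D_H` with `g` occurs in different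
  -- orders in the expansion; symmetry aligns them.
  have R5 := hcup_symm hbr.symm (sf.2.star hH') sg.2
  -- The image of each inner bracket under `psi` becomes a commutator for `⋄`, so that `R1`, `R2`,
  -- `R3` apply.
  rw [suspendedOBracket_eq br ρ m (n + p), suspendedOBracket_eq br ρ (m + n) p,
    suspendedOBracket_eq br ρ n (m + p), psi_suspendedOBracket hρ hf hg,
    psi_suspendedOBracket hρ hf hh, psi_suspendedOBracket hρ hg hh, suspendedOBracket_eq,
    suspendedOBracket_eq, suspendedOBracket_eq]
  simp only [clBracket, corestr_sub, corestr_units_smul, star_sub_left, star_sub_right,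
    star_units_smul_left, star_units_smul_right, hcup_sub_left, hcup_sub_right,
    hcup_units_smul_left, hcup_units_smul_right, star_hcup br (p - 1) sg.1 sh.1 hF',
    star_hcup br (n - 1) sf.1 sg.1 hH', star_hcup br (p - 1) sf.1 sh.1 hG', smul_sub, smul_add,
    smul_smul, mul_add, add_mul, sub_mul, one_mul, sub_add_cancel, mul_sub, mul_one,
    Int.negOnePow_add, Int.negOnePow_sub] at R1 R2 R3 R4 R5 ⊢
  rw [show n - 1 + (p - 1) + 1 = n + p - 1 by ring, show m - 1 + (p - 1) + 1 = m + p - 1 by ring]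
    at R4
  rw [show m - 1 + p = m + p - 1 by ring] at R5
  rw [show p - 1 + m = m + p - 1 by ring, show n - 1 + p = n + p - 1 by ring,
    show p - 1 + n = n + p - 1 by ring, mul_comm n m, mul_comm p m, R5, mul_comm p n]
  generalize Int.negOnePow (m * n) = s at *
  generalize Int.negOnePow (m * p) = t at *
  generalize Int.negOnePow (n * p) = u at *
  generalize Int.negOnePow m = a at *
  generalize Int.negOnePow n = b at *
  have R2 := congrArg (s • ·) R2
  have R3 := congrArg ((t * u) • ·) R3
  have R4 := congrArg ((a * b) • ·) R4
  simp only [mul_comm, mul_left_comm, mul_assoc, mul_neg, mul_one, Units.neg_smul, smul_neg,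
    Int.negOnePow_one, smul_add, smul_smul, Int.units_mul_self, units_mul_self_mul]
    at R1 R2 R3 R4 ⊢
  linear_combination (norm := abel1) -R1 + R2 - R3 + R4

theorem isGradedLieAlgebra_suspendedOBracket (hbr : IsSymmGradedLieAlgebra 𝒢 br)
    (hρ : IsSymmGradedLieRep 𝒱 𝒢 br ρ) :
    IsGradedLieAlgebra (suspendedC 𝒱 𝒢) (suspendedOBracket 𝒱 br ρ) where
  bracket_mem m n x hx y hy := suspendedOBracket_mem hbr hρ hx hy
  add_left m n x _ x' _ y _ := by
    simp only [suspendedOBracket_eq, map_add, corestr_add, star_add_left, star_add_right,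
      hcup_add_left, smul_add]
    abel
  smul_left m n a x _ y _ := by
    simp only [suspendedOBracket_eq, map_smul, corestr_smul, star_smul_left, star_smul_right,
      hcup_smul_left, smul_sub]
    rw [smul_comm a, smul_comm a]
  add_right m n x _ y _ y' _ := by
    simp only [suspendedOBracket_eq, map_add, corestr_add, star_add_left, star_add_right,
      hcup_add_right, smul_add]
    abel
  smul_right m n a x _ y _ := by
    simp only [suspendedOBracket_eq, map_smul, corestr_smul, star_smul_left, star_smul_right,
      hcup_smul_right, smul_sub]
    rw [smul_comm a, smul_comm a]
  skew m n x hx y hy := by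
    have := hcup_symm hbr.symm (mem_symHom_iff.1 hx).2 (mem_symHom_iff.1 hy).2
    rw [suspendedOBracket_eq, suspendedOBracket_eq, this]
    simp only [smul_sub, smul_smul, mul_sub, sub_mul, one_mul, mul_one, Int.negOnePow_sub,
      Int.negOnePow_one, mul_comm n m, Int.units_mul_self, one_smul]
    generalize Int.negOnePow (m * n) = s at *
    generalize Int.negOnePow m = a at *
    generalize Int.negOnePow n = b at *
    rcases Int.units_eq_one_or s with rfl | rfl <;> rcases Int.units_eq_one_or a with rfl | rfl <;>
      rcases Int.units_eq_one_or b with rfl | rfl <;> simp <;> abel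
  jacobi m n p x hx y hy z hz := suspendedOBracket_jacobi hbr hρ hx hy hz

end OBracket
end
end HomotopyOOperator

/-! ### The homomorphism `Ψ` of graded Lie algebras -/

theorem mainTheorem6 {K V 𝔤 : Type*} [Field K] [AddCommGroup V] [Module K V]
    [AddCommGroup 𝔤] [Module K 𝔤]
    (𝒱 : ℤ → Submodule K V) [DirectSum.Decomposition 𝒱]
    (𝒢 : ℤ → Submodule K 𝔤) [DirectSum.Decomposition 𝒢]
    (br : 𝔤 →ₗ[K] 𝔤 →ₗ[K] 𝔤) (hbr : HomotopyOOperator.IsSymmGradedLieAlgebra 𝒢 br)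
    (ρ : 𝔤 →ₗ[K] Module.End K V) (hρ : HomotopyOOperator.IsSymmGradedLieRep 𝒱 𝒢 br ρ) :
    HomotopyOOperator.IsGradedLieHom
      (HomotopyOOperator.suspendedC 𝒱 𝒢) (HomotopyOOperator.suspendedOBracket 𝒱 br ρ)
      (HomotopyOOperator.barC 𝒱) (HomotopyOOperator.clBracket 𝒱)
      (HomotopyOOperator.psi ρ) where
  source := HomotopyOOperator.isGradedLieAlgebra_suspendedOBracket hbr hρ
  target := HomotopyOOperator.isGradedLieAlgebra_clBracket 𝒱
  map_mem _ _ hx := HomotopyOOperator.psi_mem hρ hx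
  map_bracket _ _ _ hx _ hy := HomotopyOOperator.psi_suspendedOBracket hρ hx hy
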